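/- Let $n_A,n_B\ge 0$, $\mathcal H_A=(\mathbb C^2)^{\otimes n_A}$, $\mathcal H_B=(\mathbb C^2)^{\otimes n_B}$, let $U$ be a unitary on $\mathcal H_A\otimes\mathcal H_B$ and let $\varepsilon>0$. Then there is an $N$ such that for every $m\ge N$ there is a protocol for Alice and Bob, using $m$ shared EPR pairs, local operations and one round of simultaneous mutual classical communication, with the following property. For every Hilbert space $\mathcal H_E$ and every unit vector $|\psi\rangle\in\mathcal H_A\otimes\mathcal H_B\otimes\mathcal H_E$, if Alice holds $A$, Bob holds $B$, and the initial state of $ABE$ is $|\psi\rangle$, then, except with probability at most $\varepsilon$ (over the measurement outcomes), the final state of $ABE$ is $|\varphi\rangle=(U\otimes\mathbb I_E)|\psi\rangle$ (up to a global phase). Here a local operation is a quantum measurement on a finite-dimensional system, given by finitely many operators $M_o$ (into a possibly different finite-dimensional space) with $\sum_o M_o^\dagger M_o=\mathbb I$. In the protocol, Alice first performs a local operation on $A$ and her halves of the EPR pairs, and Bob performs one on $B$ and his halves. Then each sends the other, simultaneously, a classical message that is a function of the sender's own outcome. Finally each performs a local operation on the kept quantum register, chosen depending on the own outcome and the received message,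 which leaves Alice with $n_A$ qubits as the final system $A$ and Bob with $n_B$ qubits as the final system $B$. The protocol depends on $U$, $\varepsilon$ and $m$, but not on $\mathcal H_E$ or $|\psi\rangle$. -/

import Mathlib

open scoped Kronecker Matrix

universe u

noncomputable section

namespace NonlocalComputation

/-- Bit strings `{0,1}ⁿ`: they label the computational basis `|x⟩` of the state space
`(ℂ²)^{⊗ n} = ℂ^(Bits n)` of `n` qubits. The joint space of registers with basis labels `I` and
`J` has basis labels `I × J`, with `|(i, j)⟩ = |i⟩ ⊗ |j⟩`, and the tensor product of operators is
the Kronecker product `⊗ₖ` of their matrices. -/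
abbrev Bits (n : ℕ) : Type := Fin n → Fin 2

/-- The amplitude at `|s⟩ ⊗ |t⟩` of `m` EPR pairs: collecting the first halves in the first register
and the second halves in the second register, `((|00⟩ + |11⟩)/√2)^{⊗ m}` is
`2^{-m/2} ∑ₛ |s⟩ ⊗ |s⟩`, with `s ∈ {0,1}ᵐ`. -/
def eprPairs (m : ℕ) (s t : Bits m) : ℂ :=
  if s = t then (((1 / Real.sqrt 2) ^ m : ℝ) : ℂ) else 0

/-- The isometry that adjoins `m` EPR pairs to the joint input `AB`: it maps `|x⟩ ⊗ |y⟩` to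
`∑ (eprPairs m s t) (|x⟩ ⊗ |s⟩) ⊗ (|y⟩ ⊗ |t⟩)`, so that Alice holds `A` and the first halves, and
Bob holds `B` and the second halves. -/
def adjoinEPR (nA nB m : ℕ) :
    Matrix ((Bits nA × Bits m) × (Bits nB × Bits m)) (Bits nA × Bits nB) ℂ :=
  fun i j => if (i.1.1, i.2.1) = j then eprPairs m i.1.2 i.2.2 else 0

/-- A local operation with input register `ℂ^In`, output register `ℂ^Post` and classical outcomes
in `Out`, given by its measurement (Kraus) operators `op o`, with `∑ₒ (op o)† (op o) = 1`.
Outcome `o` leaves the unnormalized post-measurement state `op o v`, and its probability is the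
squared norm. Unitaries, adding or discarding ancillas, local randomness, and general quantum
channels (ignore the outcome) are all of this form. -/
structure LocalOperation (Out In Post : Type) [Fintype Out] [Fintype In] [DecidableEq In]
    [Fintype Post] where
  op : Out → Matrix Post In ℂ
  complete : ∑ o, (op o)ᴴ * op o = 1

/-- A protocol for Alice (input: `nA` qubits) and Bob (input: `nB` qubits) who share `m` EPR
pairs and use one round of simultaneous classical communication.
* Alice acts on her input and on her halves of the EPR pairs; she obtains a classical outcome `a`,
  keeps a quantum register of dimension `dA`, and sends the message `msgA a`. Bob does the same on
  his side, without having received anything.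
* After this single exchange, Alice acts on her register by an operation that depends only on her
  outcome and on the message received from Bob, and is left with `nA` qubits; likewise Bob. -/
structure OneRoundProtocol (nA nB m : ℕ) where
  (OutA OutB MsgA MsgB FinalA FinalB : Type)
  [fintypeOutA : Fintype OutA]
  [fintypeOutB : Fintype OutB]
  [fintypeMsgA : Fintype MsgA]
  [fintypeMsgB : Fintype MsgB]
  [fintypeFinalA : Fintype FinalA]
  [fintypeFinalB : Fintype FinalB]
  (dA dB : ℕ)
  firstA : LocalOperation OutA (Bits nA × Bits m) (Fin dA)
  firstB : LocalOperation OutB (Bits nB × Bits m) (Fin dB)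
  msgA : OutA → MsgA
  msgB : OutB → MsgB
  secondA : OutA → MsgB → LocalOperation FinalA (Fin dA) (Bits nA)
  secondB : OutB → MsgA → LocalOperation FinalB (Fin dB) (Bits nB)

attribute [instance] OneRoundProtocol.fintypeOutA OneRoundProtocol.fintypeOutB
  OneRoundProtocol.fintypeMsgA OneRoundProtocol.fintypeMsgB
  OneRoundProtocol.fintypeFinalA OneRoundProtocol.fintypeFinalB

/-- The state space `H_A ⊗ H_B ⊗ H_E` of the tripartite system `ABE`, where `A` and `B` consist of
`nA` and `nB` qubits and `E` is any Hilbert space. As `H_A ⊗ H_B` has the finite orthonormal basis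
`|x⟩ ⊗ |y⟩`, this is the Hilbert sum of copies of `E` indexed by `(x, y)`: the vector `ψ` stands
for `∑ |x⟩ ⊗ |y⟩ ⊗ ψ (x, y)`, and `‖ψ‖² = ∑ ‖ψ (x, y)‖²`. -/
abbrev StateABE (nA nB : ℕ) (E : Type*) : Type _ :=
  PiLp 2 (fun _ : Bits nA × Bits nB => E)

section

variable {nA nB m : ℕ} {E : Type*} [NormedAddCommGroup E] [InnerProductSpace ℂ E]

/-- The action `(T ⊗ 𝕀) ψ` on `ABE` of a matrix `T` acting on `AB`. -/
def applyAB (T : Matrix (Bits nA × Bits nB) (Bits nA × Bits nB) ℂ) (ψ : StateABE nA nB E) :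
    StateABE nA nB E :=
  WithLp.toLp 2 fun i => ∑ j, T i j • ψ j

/-- The classical record of an execution: the outcomes of Alice's and Bob's first operations, and
those of their second operations. -/
abbrev OneRoundProtocol.Record (P : OneRoundProtocol nA nB m) : Type :=
  (P.OutA × P.OutB) × (P.FinalA × P.FinalB)

/-- The operator on `AB` that the execution with classical record `r` implements: adjoin the EPR
pairs, apply the two first operations in parallel, exchange the messages, and apply the two second
operations in parallel. -/
def OneRoundProtocol.outcomeOp (P : OneRoundProtocol nA nB m) (r : P.Record) :
    Matrix (Bits nA × Bits nB) (Bits nA × Bits nB) ℂ :=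
  (((P.secondA r.1.1 (P.msgB r.1.2)).op r.2.1) ⊗ₖ ((P.secondB r.1.2 (P.msgA r.1.1)).op r.2.2)) *
    ((P.firstA.op r.1.1) ⊗ₖ (P.firstB.op r.1.2)) * adjoinEPR nA nB m

/-- The unnormalized final state on `ABE` of the execution on `ψ` with classical record `r`. -/
def OneRoundProtocol.outcomeState (P : OneRoundProtocol nA nB m) (ψ : StateABE nA nB E)
    (r : P.Record) : StateABE nA nB E :=
  applyAB (P.outcomeOp r) ψ

/-- The probability of the classical record `r` in the execution on `ψ` (Born rule). -/
def OneRoundProtocol.prob (P : OneRoundProtocol nA nB m) (ψ : StateABE nA nB E)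
    (r : P.Record) : ℝ :=
  ‖P.outcomeState ψ r‖ ^ 2

open Classical in
/-- The probability that the execution on `ψ` does not end in the pure state `φ`. A final state is
`φ` if its vector is a scalar multiple of `φ` (vectors are unnormalized, and states are rays). -/
def OneRoundProtocol.failureProb (P : OneRoundProtocol nA nB m) (ψ φ : StateABE nA nB E) : ℝ :=
  ∑ r : P.Record with ¬ ∃ z : ℂ, P.outcomeState ψ r = z • φ, P.prob ψ r

end

end NonlocalComputation

end

/-!
The protocol combines ordinary teleportation with an exact, heralded form of port-based
teleportation. Alice teleports `A` to Bob, who then holds `AB` up to a Pauli error `p` known to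
Alice only. Without correcting it, Bob sends all of `AB` back by port-based teleportation: his
measurement has outcomes `i` after which the state is *exactly* in the `i`-th of `N + 1` ports on
Alice's side, with nothing left to correct, and failure outcomes of total probability at most `ε`.
Alice cannot know `i`, but she can undo `p`, apply `U` and teleport the `B`-part to Bob in every
port separately. All of this takes place before any message is read. After the exchange of the
outcomes, Alice keeps the `A`-part of the port `i`, and Bob corrects the Pauli error of the
`B`-part that belongs to this port (`sum_second_mul_first`). The remaining ports only contribute a
scalar factor to the operator of the execution, whose squared modulus sums up to the success
probability of the port-based teleportation (`sum_norm_sq_success`). As all probabilities add up to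
one, no other records need to be looked at (`OneRoundProtocol.failureProb_le`).

The heart of the matter is `exists_portBasedTeleportation`. Let `Ψ i` adjoin to a state of `N`
registers a maximally entangled pair formed by the input and the `i`-th port. Measurement operators
`T (Ψ i)†`, with `T` acting on the other ports only, teleport exactly, and they can be completed to
a measurement if `∑ Ψ i T† T (Ψ i)† ≤ 1`. For `T` proportional to `1`, the largest eigenvalue of
this sum is about `d` times its typical eigenvalue, which spoils the success probability; the large
eigenvalues come from states of the ports with a large value of the Casimir operator. These are
damped by `T = β^(-1/2) (1 + c C)⁻¹`, where `C = ∑ F† F` for the collective operators `F` on `N`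
registers that belong to the traceless parts of the matrix units. Three facts are needed.

* There are operators `L` on the input and all ports with `L Ψ i = Ψ i F` (`linkOp`), because a
  maximally entangled pair is invariant under `Ū ⊗ U`. So the resolvent can be pulled through `Ψ i`
  (`gramResolvent_mul_of_intertwining`), and it suffices to bound `∑ Ψ i (Ψ i)†` on the range of the
  resolvent built from the `L`.
* Up to the scalar `d + N / d`, the operator `∑ Ψ i (Ψ i)†` is `∑ (|a⟩⟨b| ⊗ 1) L` with `L` belonging
  to `|a⟩⟨b|`. The inequality between arithmetic and geometric means bounds it by `N / d` plus lower
  order terms on vectors on which the `L` are small (`sum_norm_sq_portEmbedding_le`).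
* The trace of `C` is only `O(N)` relative to the dimension
  (`card_mul_sum_norm_sq_collective`), whereas `1 / c` grows like a large multiple of `N`, so the
  resolvent changes the success probability very little
  (`le_sum_norm_sq_gramResolvent_entries`).
-/

noncomputable section

namespace NonlocalComputation

open scoped ComplexOrder

/-! ### Success probability of a protocol -/

theorem norm_sq_applyAB {nA nB : ℕ} {E : Type*} [NormedAddCommGroup E] [InnerProductSpace ℂ E]
    (T : Matrix (Bits nA × Bits nB) (Bits nA × Bits nB) ℂ) (ψ : StateABE nA nB E) :
    ((‖applyAB T ψ‖ ^ 2 : ℝ) : ℂ) = ∑ j, ∑ k, (Tᴴ * T) j k * inner ℂ (ψ j) (ψ k) := by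
  have h : ∀ i, ((‖∑ j, T i j • ψ j‖ ^ 2 : ℝ) : ℂ)
      = ∑ j, ∑ k, star (T i j) * T i k * inner ℂ (ψ j) (ψ k) := by
    intro i
    have := inner_self_eq_norm_sq_to_K (𝕜 := ℂ) (∑ j, T i j • ψ j)
    push_cast
    rw [RCLike.ofReal_eq_complex_ofReal] at this
    rw [← this, sum_inner]
    refine Finset.sum_congr rfl fun j _ => ?_
    rw [inner_sum]
    refine Finset.sum_congr rfl fun k _ => ?_
    rw [inner_smul_left, inner_smul_right]
    simp only [starRingEnd_apply]
    ring
  rw [PiLp.norm_sq_eq_of_L2]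
  push_cast
  have h' : ∀ i, ((‖(applyAB T ψ) i‖ : ℂ)) ^ 2
      = ∑ j, ∑ k, star (T i j) * T i k * inner ℂ (ψ j) (ψ k) := by
    intro i
    rw [← h i]
    simp [applyAB]
  simp_rw [h', Matrix.mul_apply, Matrix.conjTranspose_apply, Finset.sum_mul]
  rw [Finset.sum_comm]
  refine Finset.sum_congr rfl fun j _ => ?_
  rw [Finset.sum_comm]

/-- Born probabilities of a complete family of operators on `AB` add up to the squared norm of the
state, whatever the reference system `E` is. -/
theorem sum_norm_sq_applyAB {nA nB : ℕ} {E : Type*} [NormedAddCommGroup E] [InnerProductSpace ℂ E]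
    {ι : Type*} [Fintype ι] (K : ι → Matrix (Bits nA × Bits nB) (Bits nA × Bits nB) ℂ)
    (hK : ∑ r, (K r)ᴴ * K r = 1) (ψ : StateABE nA nB E) :
    ∑ r, ‖applyAB (K r) ψ‖ ^ 2 = ‖ψ‖ ^ 2 := by
  have h1 : applyAB (1 : Matrix (Bits nA × Bits nB) (Bits nA × Bits nB) ℂ) ψ = ψ := by
    ext i
    simp [applyAB, Matrix.one_apply]
  have : ((∑ r, ‖applyAB (K r) ψ‖ ^ 2 : ℝ) : ℂ) = ((‖ψ‖ ^ 2 : ℝ) : ℂ) := by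
    conv_rhs => rw [← h1]
    rw [Complex.ofReal_sum, norm_sq_applyAB]
    simp_rw [norm_sq_applyAB]
    rw [Finset.sum_comm]
    refine Finset.sum_congr rfl fun j _ => ?_
    rw [Finset.sum_comm]
    refine Finset.sum_congr rfl fun k _ => ?_
    rw [← Finset.sum_mul, ← Matrix.sum_apply, hK]
    simp
  exact_mod_cast this

theorem applyAB_smul {nA nB : ℕ} {E : Type*} [NormedAddCommGroup E] [InnerProductSpace ℂ E]
    (z : ℂ) (T : Matrix (Bits nA × Bits nB) (Bits nA × Bits nB) ℂ) (ψ : StateABE nA nB E) :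
    applyAB (z • T) ψ = z • applyAB T ψ := by
  ext i
  simp [applyAB, Finset.smul_sum, smul_smul]

theorem norm_applyAB_of_unitary {nA nB : ℕ} {E : Type*} [NormedAddCommGroup E]
    [InnerProductSpace ℂ E] {U : Matrix (Bits nA × Bits nB) (Bits nA × Bits nB) ℂ}
    (hU : U ∈ Matrix.unitaryGroup (Bits nA × Bits nB) ℂ) (ψ : StateABE nA nB E) :
    ‖applyAB U ψ‖ ^ 2 = ‖ψ‖ ^ 2 := by
  have := sum_norm_sq_applyAB (ι := Unit) (fun _ => U)
    (by simpa [Matrix.star_eq_conjTranspose] using Matrix.mem_unitaryGroup_iff'.1 hU) ψ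
  simpa using this

theorem epr_amplitude_sq (m : ℕ) : ((1 / Real.sqrt 2) ^ m : ℝ) ^ 2 = ((2 : ℝ) ^ m)⁻¹ := by
  rw [← pow_mul, mul_comm, pow_mul, div_pow, Real.sq_sqrt (by norm_num)]
  simp

theorem kronecker_mul_adjoinEPR_apply {nA nB m : ℕ} {K L : Type*}
    (S : Matrix K (Bits nA × Bits m) ℂ) (T : Matrix L (Bits nB × Bits m) ℂ) (k : K × L)
    (z : Bits nA × Bits nB) :
    ((S ⊗ₖ T) * adjoinEPR nA nB m) k z
      = (((1 / Real.sqrt 2) ^ m : ℝ) : ℂ) * ∑ s, S k.1 (z.1, s) * T k.2 (z.2, s) := by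
  rw [Matrix.mul_apply, Fintype.sum_prod_type, Finset.mul_sum]
  simp only [Fintype.sum_prod_type, Matrix.kroneckerMap_apply, adjoinEPR, eprPairs]
  rw [Finset.sum_eq_single z.1]
  · refine Finset.sum_congr rfl fun s _ => ?_
    rw [Finset.sum_eq_single z.2]
    · rw [Finset.sum_eq_single s]
      · simp; ring
      · intro t _ ht; simp [ht.symm]
      · simp
    · intro y _ hy
      exact Finset.sum_eq_zero fun t _ => by simp [Prod.ext_iff, hy]
    · simp
  · intro x _ hx
    exact Finset.sum_eq_zero fun s _ => Finset.sum_eq_zero fun y _ => Finset.sum_eq_zero fun t _ =>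
      by simp [Prod.ext_iff, hx]
  · simp

theorem adjoinEPR_isometry (nA nB m : ℕ) :
    (adjoinEPR nA nB m)ᴴ * adjoinEPR nA nB m = 1 := by
  ext z z'
  have h := epr_amplitude_sq m
  have h' : ((((1 / Real.sqrt 2) ^ m : ℝ) : ℂ)) * ((((1 / Real.sqrt 2) ^ m : ℝ) : ℂ))
      = ((2 : ℂ) ^ m)⁻¹ := by
    rw [← sq, ← Complex.ofReal_pow, h]; push_cast; rfl
  rw [Matrix.mul_apply]
  simp only [Matrix.conjTranspose_apply, adjoinEPR, eprPairs, Fintype.sum_prod_type]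
  have : ∀ (x : Bits nA) (s : Bits m) (y : Bits nB) (t : Bits m),
      star (if (x, y) = z then if s = t then (((1 / Real.sqrt 2) ^ m : ℝ) : ℂ) else 0 else 0) *
        (if (x, y) = z' then if s = t then (((1 / Real.sqrt 2) ^ m : ℝ) : ℂ) else 0 else 0)
      = if s = t then (if x = z.1 then if y = z.2 then if z = z' then ((2 : ℂ) ^ m)⁻¹
          else 0 else 0 else 0) else 0 := by
    intro x s y t
    by_cases h1 : s = t
    · by_cases h2 : (x, y) = z
      · subst h2
        by_cases h3 : (x, y) = z'
        · simp only [h1, h3, if_true, ← h']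
          simp
        · simp [h1, h3]
      · have : ¬ (x = z.1 ∧ y = z.2) := fun h => h2 (Prod.ext h.1 h.2)
        simp only [h2, if_false, star_zero, zero_mul]
        split_ifs <;> simp_all
    · simp [h1]
  simp_rw [this]
  simp [Matrix.one_apply]

/-- Measuring first with one complete family and then, depending on the outcome, with another one,
is again a complete measurement. -/
theorem sum_comp_conjTranspose_mul {ι κ l m n : Type*} [Fintype ι] [Fintype κ] [Fintype l]
    [Fintype m] [DecidableEq m] [Fintype n] (S : ι → κ → Matrix l m ℂ) (T : ι → Matrix m n ℂ)
    (hS : ∀ i, ∑ k, (S i k)ᴴ * S i k = 1) :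
    ∑ r : ι × κ, (S r.1 r.2 * T r.1)ᴴ * (S r.1 r.2 * T r.1) = ∑ i, (T i)ᴴ * T i := by
  rw [Fintype.sum_prod_type]
  refine Finset.sum_congr rfl fun i _ => ?_
  have : ∀ k, (S i k * T i)ᴴ * (S i k * T i) = (T i)ᴴ * ((S i k)ᴴ * S i k) * T i := by
    intro k
    simp only [Matrix.conjTranspose_mul, Matrix.mul_assoc]
  dsimp only
  simp_rw [this, ← Matrix.sum_mul, ← Matrix.mul_sum, hS, Matrix.mul_one]

theorem sum_kronecker_conjTranspose_mul {ι κ l m l' m' : Type*} [Fintype ι] [Fintype κ] [Fintype l]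
    [Fintype m] [Fintype l'] [Fintype m'] [DecidableEq m] [DecidableEq m']
    (S : ι → Matrix l m ℂ) (T : κ → Matrix l' m' ℂ)
    (hS : ∑ i, (S i)ᴴ * S i = 1) (hT : ∑ i, (T i)ᴴ * T i = 1) :
    ∑ r : ι × κ, (S r.1 ⊗ₖ T r.2)ᴴ * (S r.1 ⊗ₖ T r.2) = 1 := by
  rw [Fintype.sum_prod_type, ← Matrix.one_kronecker_one, ← hS, ← hT]
  ext ⟨a, b⟩ ⟨a', b'⟩
  simp only [Matrix.conjTranspose_kronecker, ← Matrix.mul_kronecker_mul, Matrix.sum_apply,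
    Matrix.kroneckerMap_apply, Finset.sum_mul_sum]

theorem OneRoundProtocol.sum_outcomeOp {nA nB m : ℕ} (P : OneRoundProtocol nA nB m) :
    ∑ r : P.Record, (P.outcomeOp r)ᴴ * P.outcomeOp r = 1 := by
  have h := sum_comp_conjTranspose_mul
    (fun (i : P.OutA × P.OutB) (k : P.FinalA × P.FinalB) =>
      ((P.secondA i.1 (P.msgB i.2)).op k.1) ⊗ₖ ((P.secondB i.2 (P.msgA i.1)).op k.2))
    (fun i => ((P.firstA.op i.1) ⊗ₖ (P.firstB.op i.2)) * adjoinEPR nA nB m)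
    (fun i => sum_kronecker_conjTranspose_mul _ _ (P.secondA i.1 (P.msgB i.2)).complete
      (P.secondB i.2 (P.msgA i.1)).complete)
  have h2 := sum_comp_conjTranspose_mul
    (fun (_ : Unit) (k : P.OutA × P.OutB) => (P.firstA.op k.1) ⊗ₖ (P.firstB.op k.2))
    (fun _ => adjoinEPR nA nB m)
    (fun _ => sum_kronecker_conjTranspose_mul _ _ P.firstA.complete P.firstB.complete)
  simp only [Finset.univ_unique, Finset.sum_singleton, adjoinEPR_isometry] at h2
  rw [← h2, Fintype.sum_prod_type (α₁ := Unit)]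
  simp only [Finset.univ_unique, Finset.sum_singleton]
  rw [← h]
  refine Finset.sum_congr rfl fun r _ => ?_
  simp only [OneRoundProtocol.outcomeOp, Matrix.mul_assoc]

/-- A criterion for success on all inputs at once: if the records `r` with `c r ≠ 0` implement
the multiple `c r • U` of the target, then they are successful on every input, and they have the
input-independent probability `‖c r‖²`. Nothing has to be known about the other records, as all
probabilities add up to one. -/
theorem OneRoundProtocol.failureProb_le {nA nB m : ℕ} (P : OneRoundProtocol nA nB m)
    {U : Matrix (Bits nA × Bits nB) (Bits nA × Bits nB) ℂ}
    (hU : U ∈ Matrix.unitaryGroup (Bits nA × Bits nB) ℂ) (c : P.Record → ℂ)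
    (hc : ∀ r, c r ≠ 0 → P.outcomeOp r = c r • U) {ε : ℝ} (hε : 1 - ε ≤ ∑ r, ‖c r‖ ^ 2)
    {E : Type*} [NormedAddCommGroup E] [InnerProductSpace ℂ E] (ψ : StateABE nA nB E)
    (hψ : ‖ψ‖ = 1) : P.failureProb ψ (applyAB U ψ) ≤ ε := by
  classical
  have htot := sum_norm_sq_applyAB P.outcomeOp P.sum_outcomeOp ψ
  rw [hψ, one_pow] at htot
  have hle : ∀ r, ‖c r‖ ^ 2 + (if ¬ ∃ z : ℂ, P.outcomeState ψ r = z • applyAB U ψ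
      then P.prob ψ r else 0) ≤ ‖applyAB (P.outcomeOp r) ψ‖ ^ 2 := by
    intro r
    by_cases h0 : c r = 0
    · rw [h0]
      split_ifs
      · simp
      · simp [OneRoundProtocol.prob, OneRoundProtocol.outcomeState]
    · have hs : P.outcomeState ψ r = c r • applyAB U ψ := by
        rw [OneRoundProtocol.outcomeState, hc r h0, applyAB_smul]
      rw [if_neg (not_not.2 ⟨_, hs⟩), hc r h0, applyAB_smul, norm_smul, mul_pow,
        norm_applyAB_of_unitary hU, hψ]
      simp
  have hsum := Finset.sum_le_sum fun r (_ : r ∈ Finset.univ) => hle r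
  rw [Finset.sum_add_distrib, htot, ← Finset.sum_filter] at hsum
  unfold OneRoundProtocol.failureProb
  have : ∀ x y : ℝ, ∑ r, ‖c r‖ ^ 2 + x ≤ 1 → x = y → y ≤ ε := by
    intro x y h1 h2; linarith
  refine this _ _ hsum ?_
  congr!

/-! ### Protocols from local operations on a maximally entangled resource -/

/-- Entrywise form of completeness: the columns of the stacked measurement operators are
orthonormal. -/
theorem sum_op_conj_mul_eq_one_iff {Out In Post : Type*} [Fintype Out] [Fintype In]
    [DecidableEq In] [Fintype Post] (op : Out → Matrix Post In ℂ) :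
    ∑ o, (op o)ᴴ * op o = 1 ↔
      ∀ x x', ∑ o, ∑ k, star (op o k x) * op o k x' = if x = x' then 1 else 0 := by
  rw [← Matrix.ext_iff]
  simp only [Matrix.sum_apply, Matrix.mul_apply, Matrix.conjTranspose_apply, Matrix.one_apply]

theorem LocalOperation.sum_op {Out In Post : Type} [Fintype Out] [Fintype In]
    [DecidableEq In] [Fintype Post] (A : LocalOperation Out In Post) (x x' : In) :
    ∑ o, ∑ k, star (A.op o k x) * A.op o k x' = if x = x' then 1 else 0 :=
  (sum_op_conj_mul_eq_one_iff A.op).1 A.complete x x'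

/-- A local operation on `X ⊗ ℂ^R` as one on `X ⊗ (ℂ²)^{⊗ m}`, where `m` qubits are `R` together
with a surplus register `R'` that is measured in the computational basis. The kept register is
relabelled by `Fin`. -/
def LocalOperation.pad {Out X R R' Post M : Type} [Fintype Out] [Fintype X] [DecidableEq X]
    [Fintype R] [DecidableEq R] [Fintype R'] [DecidableEq R'] [Fintype Post] [Fintype M]
    [DecidableEq M] (e : M ≃ R × R') (A : LocalOperation Out (X × R) Post) :
    LocalOperation (Out × R') (X × M) (Fin (Fintype.card Post)) where
  op o := Matrix.of fun k z => if (e z.2).2 = o.2 then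
    A.op o.1 ((Fintype.equivFin Post).symm k) (z.1, (e z.2).1) else 0
  complete := by
    rw [sum_op_conj_mul_eq_one_iff]
    simp only [Matrix.of_apply]
    rintro ⟨x, s⟩ ⟨x', s'⟩
    have h1 : ∀ (o : Out × R'), ∑ k, star (if (e s).2 = o.2 then
          A.op o.1 ((Fintype.equivFin Post).symm k) (x, (e s).1) else 0) *
        (if (e s').2 = o.2 then
          A.op o.1 ((Fintype.equivFin Post).symm k) (x', (e s').1) else 0)
        = if (e s).2 = o.2 then if (e s').2 = o.2 then
          ∑ k, star (A.op o.1 k (x, (e s).1)) * A.op o.1 k (x', (e s').1) else 0 else 0 := by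
      intro o
      rw [← Equiv.sum_comp (Fintype.equivFin Post).symm]
      split_ifs <;> simp
    simp only [h1, Fintype.sum_prod_type, Finset.sum_ite_eq, Finset.mem_univ, if_true]
    by_cases h : (e s').2 = (e s).2
    · simp only [h, if_true]
      rw [A.sum_op]
      have : s = s' ↔ (e s).1 = (e s').1 := by
        rw [← e.injective.eq_iff, Prod.ext_iff]
        simp [h]
      simp [Prod.ext_iff, this]
    · have : s ≠ s' := fun h' => h (by rw [h'])
      simp [h, Prod.ext_iff, this]

/-- A local operation with a relabelled input register. -/
def LocalOperation.reindexIn {Out In In' Post : Type} [Fintype Out] [Fintype In] [DecidableEq In]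
    [Fintype In'] [DecidableEq In'] [Fintype Post] (e : In' ≃ In) (A : LocalOperation Out In Post) :
    LocalOperation Out In' Post where
  op o := (A.op o).submatrix id e
  complete := by
    rw [sum_op_conj_mul_eq_one_iff]
    intro x x'
    simpa [e.injective.eq_iff] using A.sum_op (e x) (e x')

/-- Protocols from measurements on a maximally entangled resource `∑ₛ |s⟩ ⊗ |s⟩`, where `s` ranges
over any type `R` whose size divides `2ᵐ`, and with kept registers of any shape: the unnormalized
joint operator of the first operations is `∑ₛ A(·, s) ⊗ B(·, s)`, and the normalization enters as
the factor `card R` of the success weight. -/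
theorem exists_oneRoundProtocol {nA nB m : ℕ} {R R' LA LB OutA OutB FA FB : Type}
    [Fintype R] {_ : DecidableEq R} [Fintype R'] [DecidableEq R'] [Fintype LA]
    {_ : DecidableEq LA} [Fintype LB] {_ : DecidableEq LB} [Fintype OutA] [Fintype OutB]
    [Fintype FA] [Fintype FB]
    (e : Bits m ≃ R × R')
    (A : LocalOperation OutA (Bits nA × R) LA) (B : LocalOperation OutB (Bits nB × R) LB)
    (SA : OutA → OutB → LocalOperation FA LA (Bits nA))
    (SB : OutB → OutA → LocalOperation FB LB (Bits nB))
    {U : Matrix (Bits nA × Bits nB) (Bits nA × Bits nB) ℂ}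
    (hU : U ∈ Matrix.unitaryGroup (Bits nA × Bits nB) ℂ)
    (c : OutA → OutB → FA → FB → ℂ)
    (hc : ∀ α β f h, c α β f h ≠ 0 → ∀ i j x y,
      ∑ k, ∑ l, (SA α β).op f i k * (SB β α).op h j l *
        ∑ s, A.op α k (x, s) * B.op β l (y, s) = c α β f h * U (i, j) (x, y))
    {ε : ℝ}
    (hsum : (1 - ε) * Fintype.card R ≤ ∑ α, ∑ β, ∑ f, ∑ h, ‖c α β f h‖ ^ 2) :
    ∃ P : OneRoundProtocol nA nB m,
      ∀ (E : Type u) [NormedAddCommGroup E] [InnerProductSpace ℂ E] [CompleteSpace E]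
        (ψ : StateABE nA nB E), ‖ψ‖ = 1 → P.failureProb ψ (applyAB U ψ) ≤ ε := by
  let eA := (Fintype.equivFin LA).symm
  let eB := (Fintype.equivFin LB).symm
  let P : OneRoundProtocol nA nB m :=
    { OutA := OutA × R'
      OutB := OutB × R'
      MsgA := OutA × R'
      MsgB := OutB × R'
      FinalA := FA
      FinalB := FB
      dA := Fintype.card LA
      dB := Fintype.card LB
      firstA := A.pad e
      firstB := B.pad e
      msgA := id
      msgB := id
      secondA := fun α β => (SA α.1 β.1).reindexIn eA
      secondB := fun β α => (SB β.1 α.1).reindexIn eB }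
  let w : ℂ := (((1 / Real.sqrt 2) ^ m : ℝ) : ℂ)
  -- The surplus EPR pairs give both parties the same uniformly random string.
  let C : P.Record → ℂ := fun r =>
    if r.1.1.2 = r.1.2.2 then w * c r.1.1.1 r.1.2.1 r.2.1 r.2.2 else 0
  refine ⟨P, fun E _ _ _ ψ hψ => P.failureProb_le hU C ?_ ?_ ψ hψ⟩
  · rintro ⟨⟨⟨α, r₁⟩, ⟨β, r₂⟩⟩, ⟨f, h⟩⟩ hr
    have hrr : r₁ = r₂ := by
      by_contra hne
      exact hr (if_neg hne)
    subst hrr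
    have hC : C (((α, r₁), (β, r₁)), (f, h)) = w * c α β f h := if_pos rfl
    rw [hC] at hr ⊢
    have hcc := hc α β f h (right_ne_zero_of_mul hr)
    ext ⟨i, j⟩ ⟨x, y⟩
    rw [OneRoundProtocol.outcomeOp, Matrix.mul_assoc, Matrix.mul_apply, Fintype.sum_prod_type]
    simp only [kronecker_mul_adjoinEPR_apply, Matrix.smul_apply, smul_eq_mul, mul_assoc]
    rw [← hcc, Finset.mul_sum, ← Equiv.sum_comp (Fintype.equivFin LA)]
    refine Finset.sum_congr rfl fun k _ => ?_
    rw [Finset.mul_sum, ← Equiv.sum_comp (Fintype.equivFin LB)]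
    refine Finset.sum_congr rfl fun l _ => ?_
    have hs : ∑ s, (A.pad e).op (α, r₁) (Fintype.equivFin LA k) (x, s) *
        (B.pad e).op (β, r₁) (Fintype.equivFin LB l) (y, s)
        = ∑ s, A.op α k (x, s) * B.op β l (y, s) := by
      rw [← Equiv.sum_comp e.symm, Fintype.sum_prod_type]
      refine Finset.sum_congr rfl fun s _ => ?_
      rw [Finset.sum_eq_single r₁]
      · simp [LocalOperation.pad]
      · intro t _ ht
        simp [LocalOperation.pad, ht]
      · simp
    change (((SA α β).reindexIn eA).op f ⊗ₖ ((SB β α).reindexIn eB).op h) (i, j)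
      (Fintype.equivFin LA k, Fintype.equivFin LB l) * (w * ∑ s, (A.pad e).op (α, r₁)
        (Fintype.equivFin LA k) (x, s) * (B.pad e).op (β, r₁) (Fintype.equivFin LB l) (y, s)) = _
    rw [hs]
    simp only [Matrix.kroneckerMap_apply, LocalOperation.reindexIn, Matrix.submatrix_apply, id,
      eA, eB, Equiv.symm_apply_apply]
    ring
  · have hw : ‖w‖ ^ 2 = ((2 : ℝ) ^ m)⁻¹ := by
      rw [← epr_amplitude_sq m, Complex.norm_real, Real.norm_eq_abs, sq_abs]
    have hcard : (2 : ℝ) ^ m = Fintype.card R * Fintype.card R' := by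
      have := Fintype.card_congr e
      simp only [Fintype.card_prod, Fintype.card_pi, Fintype.card_fin, Finset.prod_const,
        Finset.card_univ] at this
      exact_mod_cast this
    have hCsum : ∑ r, ‖C r‖ ^ 2
        = Fintype.card R' * (((2 : ℝ) ^ m)⁻¹ * ∑ α, ∑ β, ∑ f, ∑ h, ‖c α β f h‖ ^ 2) := by
      have h1 : ∀ r : P.Record, ‖C r‖ ^ 2 = if r.1.1.2 = r.1.2.2 then
          ((2 : ℝ) ^ m)⁻¹ * ‖c r.1.1.1 r.1.2.1 r.2.1 r.2.2‖ ^ 2 else 0 := by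
        intro r
        simp only [C]
        split_ifs
        · rw [norm_mul, mul_pow, hw]
        · simp
      simp_rw [h1]
      change ∑ r : ((OutA × R') × (OutB × R')) × (FA × FB), (if r.1.1.2 = r.1.2.2 then
          ((2 : ℝ) ^ m)⁻¹ * ‖c r.1.1.1 r.1.2.1 r.2.1 r.2.2‖ ^ 2 else 0) = _
      simp only [Fintype.sum_prod_type]
      simp only [Finset.mul_sum]
      refine Finset.sum_congr rfl fun α _ => ?_
      rw [Finset.sum_comm]
      refine Finset.sum_congr rfl fun β _ => ?_
      have h2 : ∀ r r' : R', (∑ f, ∑ h, if r = r' then ((2 : ℝ) ^ m)⁻¹ * ‖c α β f h‖ ^ 2 else 0)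
          = if r = r' then ∑ f, ∑ h, ((2 : ℝ) ^ m)⁻¹ * ‖c α β f h‖ ^ 2 else 0 := by
        intro r r'
        split_ifs <;> simp
      simp only [h2, Finset.sum_ite_eq, Finset.mem_univ, if_true, Finset.sum_const,
        Finset.card_univ, nsmul_eq_mul, Finset.mul_sum]
    rw [hCsum]
    have hpos : (0 : ℝ) < 2 ^ m := by positivity
    calc 1 - ε = ((2 : ℝ) ^ m)⁻¹ * ((1 - ε) * (Fintype.card R * Fintype.card R')) := by
          rw [← hcard]; field_simp
      _ = Fintype.card R' * (((2 : ℝ) ^ m)⁻¹ * ((1 - ε) * Fintype.card R)) := by ring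
      _ ≤ _ := by gcongr

/-- A family of operators with `∑ K† K ≤ 1` is part of a local operation: the missing weight is
collected by further outcomes. -/
theorem exists_localOperation_extending {Out In Post : Type} [Fintype Out] [Fintype In]
    [DecidableEq In] [Fintype Post] [Nonempty Post] (K : Out → Matrix Post In ℂ)
    (hK : (1 - ∑ o, (K o)ᴴ * K o).PosSemidef) :
    ∃ (d : ℕ) (A : LocalOperation (Out ⊕ Fin d) In Post), ∀ o, A.op (Sum.inl o) = K o := by
  classical
  obtain ⟨d, v, hv⟩ := Matrix.posSemidef_iff_eq_sum_vecMulVec.1 hK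
  obtain ⟨p₀⟩ := ‹Nonempty Post›
  refine ⟨d, ⟨Sum.elim K fun i => Matrix.of fun p x => if p = p₀ then star (v i x) else 0, ?_⟩,
    fun o => rfl⟩
  have : ∀ i, (Matrix.of fun p x => if p = p₀ then star (v i x) else 0)ᴴ *
      (Matrix.of fun (p : Post) x => if p = p₀ then star (v i x) else 0)
      = Matrix.vecMulVec (v i) (star (v i)) := by
    intro i
    ext x y
    simp [Matrix.mul_apply, Matrix.vecMulVec_apply]
  rw [Fintype.sum_sum_type]
  simp only [Sum.elim_inl, Sum.elim_inr, this]
  rw [← hv, add_sub_cancel]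

/-! ### Resolvents of sums of squares -/

theorem re_star_dotProduct_self {n : Type*} [Fintype n] (v : n → ℂ) :
    (star v ⬝ᵥ v).re = ∑ i, ‖v i‖ ^ 2 := by
  rw [dotProduct, Complex.re_sum]
  refine Finset.sum_congr rfl fun i _ => ?_
  rw [Pi.star_apply, ← starRingEnd_apply, Complex.conj_mul']
  norm_cast

theorem re_star_dotProduct_conjTranspose_mul_mulVec {m n : Type*} [Fintype m] [Fintype n]
    (L : Matrix m n ℂ) (v : n → ℂ) :
    (star v ⬝ᵥ ((Lᴴ * L) *ᵥ v)).re = ∑ i, ‖(L *ᵥ v) i‖ ^ 2 := by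
  rw [← re_star_dotProduct_self, ← Matrix.mulVec_mulVec, Matrix.dotProduct_mulVec,
    ← Matrix.star_mulVec]

/-- The positive operator `c ∑ L_κ† L_κ`. -/
def gramOperator {κ n : Type*} [Fintype κ] [Fintype n] (c : ℝ) (L : κ → Matrix n n ℂ) :
    Matrix n n ℂ :=
  (c : ℂ) • ∑ a, (L a)ᴴ * L a

theorem re_star_dotProduct_gramOperator {κ n : Type*} [Fintype κ] [Fintype n] (c : ℝ)
    (L : κ → Matrix n n ℂ) (v : n → ℂ) :
    (star v ⬝ᵥ (gramOperator c L *ᵥ v)).re = c * ∑ a, ∑ i, ‖(L a *ᵥ v) i‖ ^ 2 := by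
  rw [gramOperator, Matrix.smul_mulVec, dotProduct_smul, smul_eq_mul, Complex.re_ofReal_mul,
    Matrix.sum_mulVec, dotProduct_sum, Complex.re_sum]
  simp_rw [re_star_dotProduct_conjTranspose_mul_mulVec]

theorem posSemidef_gramOperator {κ n : Type*} [Fintype κ] [Fintype n] {c : ℝ} (hc : 0 ≤ c)
    (L : κ → Matrix n n ℂ) : (gramOperator c L).PosSemidef := by
  classical
  refine Matrix.PosSemidef.smul ?_ (by exact_mod_cast hc)
  exact Matrix.posSemidef_sum _ fun a _ => Matrix.posSemidef_conjTranspose_mul_self _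

/-- The resolvent `(1 + c ∑ L_κ† L_κ)⁻¹`. It serves as a smooth substitute for the projection onto
the vectors on which all `L_κ` are small. -/
def gramResolvent {κ n : Type*} [Fintype κ] [Fintype n] [DecidableEq n] (c : ℝ)
    (L : κ → Matrix n n ℂ) : Matrix n n ℂ :=
  (1 + gramOperator c L)⁻¹

section

variable {κ n : Type*} [Fintype κ] [Fintype n] [DecidableEq n] {c : ℝ} {L : κ → Matrix n n ℂ}

theorem isUnit_det_one_add_gramOperator (hc : 0 ≤ c) (L : κ → Matrix n n ℂ) :
    IsUnit (1 + gramOperator c L).det :=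
  (Matrix.isUnit_iff_isUnit_det _).1
    (Matrix.PosDef.one.add_posSemidef (posSemidef_gramOperator hc L)).isUnit

theorem isHermitian_gramResolvent (hc : 0 ≤ c) (L : κ → Matrix n n ℂ) :
    (gramResolvent c L).IsHermitian :=
  (Matrix.isHermitian_one.add (posSemidef_gramOperator hc L).isHermitian).inv

theorem gramResolvent_mulVec_add (hc : 0 ≤ c) (L : κ → Matrix n n ℂ) (v : n → ℂ) :
    gramResolvent c L *ᵥ v + gramOperator c L *ᵥ (gramResolvent c L *ᵥ v) = v := by
  have h := Matrix.mul_nonsing_inv _ (isUnit_det_one_add_gramOperator hc L)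
  calc _ = ((1 + gramOperator c L) * gramResolvent c L) *ᵥ v := by
        rw [← Matrix.mulVec_mulVec, Matrix.add_mulVec, Matrix.one_mulVec]
    _ = v := by rw [gramResolvent, h, Matrix.one_mulVec]

theorem sum_norm_sq_add_eq {n : Type*} [Fintype n] (v w : n → ℂ) :
    ∑ i, ‖(v + w) i‖ ^ 2 = ∑ i, ‖v i‖ ^ 2 + 2 * (star v ⬝ᵥ w).re + ∑ i, ‖w i‖ ^ 2 := by
  simp_rw [← re_star_dotProduct_self]
  have : (star w ⬝ᵥ v).re = (star v ⬝ᵥ w).re := by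
    rw [← Complex.conj_re, starRingEnd_apply, Matrix.star_dotProduct, star_star, dotProduct_comm]
  rw [star_add, add_dotProduct, dotProduct_add, dotProduct_add]
  simp only [Complex.add_re, this]
  ring

/-- The resolvent is a contraction, and its range consists of vectors on which the `L_κ` are
small. -/
theorem sum_norm_sq_gramResolvent_add_le (hc : 0 ≤ c) (L : κ → Matrix n n ℂ) (v : n → ℂ) :
    ∑ i, ‖(gramResolvent c L *ᵥ v) i‖ ^ 2
      + 2 * c * ∑ a, ∑ i, ‖(L a *ᵥ (gramResolvent c L *ᵥ v)) i‖ ^ 2 ≤ ∑ i, ‖v i‖ ^ 2 := by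
  set w := gramResolvent c L *ᵥ v with hw
  have h := gramResolvent_mulVec_add hc L v
  rw [← hw] at h
  have h2 := sum_norm_sq_add_eq w (gramOperator c L *ᵥ w)
  rw [h, re_star_dotProduct_gramOperator] at h2
  have : 0 ≤ ∑ i, ‖(gramOperator c L *ᵥ w) i‖ ^ 2 := by positivity
  linarith

/-- The resolvent hardly shortens a vector on which all `L_κ` are small: `(1 + Y)⁻² ≥ 1 - 2 Y` for
`Y ≥ 0`. -/
theorem le_sum_norm_sq_gramResolvent (hc : 0 ≤ c) (L : κ → Matrix n n ℂ) (v : n → ℂ) :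
    ∑ i, ‖v i‖ ^ 2 - 2 * c * ∑ a, ∑ i, ‖(L a *ᵥ v) i‖ ^ 2
      ≤ ∑ i, ‖(gramResolvent c L *ᵥ v) i‖ ^ 2 := by
  have h := gramResolvent_mulVec_add hc L v
  obtain ⟨w, hw⟩ : ∃ w, w = gramResolvent c L *ᵥ v := ⟨_, rfl⟩
  obtain ⟨Y, hY⟩ : ∃ Y, Y = gramOperator c L := ⟨_, rfl⟩
  rw [← hw, ← hY] at h
  rw [← hw]
  have hH : Y.IsHermitian := hY ▸ (posSemidef_gramOperator hc L).isHermitian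
  have h2 := sum_norm_sq_add_eq w (Y *ᵥ w)
  rw [h] at h2
  have h3 : c * ∑ a, ∑ i, ‖(L a *ᵥ v) i‖ ^ 2 = (star v ⬝ᵥ (Y *ᵥ v)).re := by
    rw [hY, re_star_dotProduct_gramOperator]
  have h4 : (star w ⬝ᵥ (Y *ᵥ (Y *ᵥ w))).re = ∑ i, ‖(Y *ᵥ w) i‖ ^ 2 := by
    rw [← re_star_dotProduct_conjTranspose_mul_mulVec, hH.eq, Matrix.mulVec_mulVec]
  have h5 : (star (Y *ᵥ w) ⬝ᵥ (Y *ᵥ w)).re = ∑ i, ‖(Y *ᵥ w) i‖ ^ 2 := re_star_dotProduct_self _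
  have hpos : ∀ u : n → ℂ, 0 ≤ (star u ⬝ᵥ (Y *ᵥ u)).re := by
    intro u
    rw [hY]
    exact (posSemidef_gramOperator hc L).re_dotProduct_nonneg u
  have h6 : 0 ≤ (star (Y *ᵥ w) ⬝ᵥ (Y *ᵥ (Y *ᵥ w))).re := hpos _
  have h7 : 0 ≤ (star w ⬝ᵥ (Y *ᵥ w)).re := hpos w
  have h8 : (star v ⬝ᵥ (Y *ᵥ v)).re = (star w ⬝ᵥ (Y *ᵥ w)).re
      + (star w ⬝ᵥ (Y *ᵥ (Y *ᵥ w))).re + (star (Y *ᵥ w) ⬝ᵥ (Y *ᵥ w)).re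
      + (star (Y *ᵥ w) ⬝ᵥ (Y *ᵥ (Y *ᵥ w))).re := by
    conv_lhs => rw [← h]
    rw [Matrix.mulVec_add, star_add, add_dotProduct, dotProduct_add, dotProduct_add]
    simp only [Complex.add_re]
    ring
  have h9 : 0 ≤ ∑ i, ‖(Y *ᵥ w) i‖ ^ 2 := by positivity
  rw [mul_assoc, h3, h8, h2, h4, h5]
  linarith only [h6, h7, h9]

/-- The resolvent inherits the intertwining relations of the `L_κ`. -/
theorem gramResolvent_mul_of_intertwining {p : Type*} [Fintype p] [DecidableEq p]
    {F : κ → Matrix p p ℂ} (hc : 0 ≤ c) (Ψ : Matrix n p ℂ) (h : ∀ a, L a * Ψ = Ψ * F a)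
    (h' : ∀ a, (L a)ᴴ * Ψ = Ψ * (F a)ᴴ) :
    gramResolvent c L * Ψ = Ψ * gramResolvent c F := by
  have hY : (1 + gramOperator c L) * Ψ = Ψ * (1 + gramOperator c F) := by
    rw [Matrix.add_mul, Matrix.mul_add, Matrix.one_mul, Matrix.mul_one, gramOperator, gramOperator,
      Matrix.smul_mul, Matrix.mul_smul, Matrix.sum_mul, Matrix.mul_sum]
    congr 2
    refine Finset.sum_congr rfl fun a _ => ?_
    rw [Matrix.mul_assoc, h, ← Matrix.mul_assoc, h', Matrix.mul_assoc]
  have h1 := Matrix.nonsing_inv_mul _ (isUnit_det_one_add_gramOperator hc L)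
  have h2 := Matrix.mul_nonsing_inv _ (isUnit_det_one_add_gramOperator hc F)
  calc gramResolvent c L * Ψ = gramResolvent c L * (Ψ * (1 + gramOperator c F))
        * gramResolvent c F := by
        rw [gramResolvent, gramResolvent, Matrix.mul_assoc, Matrix.mul_assoc, h2, Matrix.mul_one]
    _ = Ψ * gramResolvent c F := by
        rw [← hY, gramResolvent, ← Matrix.mul_assoc, h1, Matrix.one_mul]

/-- The Frobenius form of `le_sum_norm_sq_gramResolvent`. -/
theorem le_sum_norm_sq_gramResolvent_entries (hc : 0 ≤ c) (L : κ → Matrix n n ℂ) :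
    Fintype.card n - 2 * c * ∑ a, ∑ i, ∑ j, ‖L a i j‖ ^ 2
      ≤ ∑ i, ∑ j, ‖gramResolvent c L i j‖ ^ 2 := by
  have h := Finset.sum_le_sum fun j (_ : j ∈ Finset.univ) =>
    le_sum_norm_sq_gramResolvent hc L (Pi.single j 1)
  simp only [Matrix.mulVec_single_one, Matrix.col_apply] at h
  have hcomm : ∑ j, ∑ a, ∑ i, ‖L a i j‖ ^ 2 = ∑ a, ∑ i, ∑ j, ‖L a i j‖ ^ 2 := by
    rw [Finset.sum_comm]
    exact Finset.sum_congr rfl fun a _ => Finset.sum_comm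
  rw [Finset.sum_sub_distrib, ← Finset.mul_sum, hcomm] at h
  rw [Finset.sum_comm (f := fun i j => ‖gramResolvent c L i j‖ ^ 2)]
  refine le_trans (le_of_eq ?_) h
  congr 1
  have : ∀ j : n, ∑ i, ‖(Pi.single j 1 : n → ℂ) i‖ ^ 2 = 1 := by
    intro j
    rw [Finset.sum_eq_single j]
    · simp
    · intro i _ hi; simp [hi]
    · simp
  simp [this]

end

/-! ### Collective operators on the ports -/

/-- The collective operator `∑ₖ X⁽ᵏ⁾` on `N` registers with basis labels `D`, where `X⁽ᵏ⁾` acts as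
`X` on the `k`-th register. -/
def collective {D : Type*} [DecidableEq D] {N : ℕ} (X : Matrix D D ℂ) :
    Matrix (Fin N → D) (Fin N → D) ℂ :=
  Matrix.of fun s t => ∑ k, if ∀ j, j ≠ k → s j = t j then X (s k) (t k) else 0

section

variable {D : Type*} [DecidableEq D] {N : ℕ}

theorem collective_sub (X Y : Matrix D D ℂ) :
    collective (N := N) (X - Y) = collective X - collective Y := by
  ext s t
  simp only [collective, Matrix.of_apply, Matrix.sub_apply, ← Finset.sum_sub_distrib]
  exact Finset.sum_congr rfl fun k _ => by split_ifs <;> simp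

theorem collective_smul_one (z : ℂ) :
    collective (N := N) (z • (1 : Matrix D D ℂ)) = ((N : ℂ) * z) • 1 := by
  ext s t
  have : ∀ k, (if ∀ j, j ≠ k → s j = t j then (z • (1 : Matrix D D ℂ)) (s k) (t k) else 0)
      = if s = t then z else 0 := by
    intro k
    by_cases h : s = t
    · simp [h]
    · by_cases h' : ∀ j, j ≠ k → s j = t j
      · have hk : s k ≠ t k := fun hk => h (funext fun j => by
          by_cases hj : j = k
          · rw [hj, hk]
          · exact h' j hj)
        rw [if_pos h', if_neg h]
        simp [hk]
      · rw [if_neg h', if_neg h]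
  simp only [collective, Matrix.of_apply, this]
  by_cases h : s = t <;> simp [h]

theorem collective_conjTranspose (X : Matrix D D ℂ) :
    (collective (N := N) X)ᴴ = collective Xᴴ := by
  ext s t
  simp only [collective, Matrix.of_apply, Matrix.conjTranspose_apply, star_sum]
  refine Finset.sum_congr rfl fun k _ => ?_
  rw [apply_ite star, star_zero]
  congr 1
  simp [eq_comm]

theorem forall_ne_insertNth_eq_iff {D : Type*} (i : Fin (N + 1)) (x y : D) (s t : Fin N → D) :
    (∀ j, j ≠ i → (i.insertNth x s : Fin (N + 1) → D) j = (i.insertNth y t : Fin (N + 1) → D) j)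
      ↔ s = t := by
  rw [Fin.forall_iff_succAbove i]
  simp [funext_iff, Fin.succAbove_ne]

theorem forall_ne_succAbove_insertNth_eq_iff {D : Type*} (i : Fin (N + 1)) (l : Fin N) (x y : D)
    (s t : Fin N → D) :
    (∀ j, j ≠ i.succAbove l →
      (i.insertNth x s : Fin (N + 1) → D) j = (i.insertNth y t : Fin (N + 1) → D) j)
      ↔ x = y ∧ ∀ j, j ≠ l → s j = t j := by
  rw [Fin.forall_iff_succAbove i]
  simp [(Fin.succAbove_ne i l).symm]

/-- Splitting off the `i`-th register, a collective operator is `X ⊗ 1 + 1 ⊗ collective X`. -/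
theorem collective_insertNth (X : Matrix D D ℂ) (i : Fin (N + 1)) (x y : D) (s t : Fin N → D) :
    collective X (i.insertNth x s : Fin (N + 1) → D) (i.insertNth y t : Fin (N + 1) → D)
      = (if s = t then X x y else 0) + if x = y then collective X s t else 0 := by
  rw [collective, Matrix.of_apply, Fin.sum_univ_succAbove _ i]
  simp only [forall_ne_insertNth_eq_iff, forall_ne_succAbove_insertNth_eq_iff,
    Fin.insertNth_apply_same, Fin.insertNth_apply_succAbove]
  congr 1
  by_cases h : x = y <;> simp [h, collective]

theorem sum_insertNth {D M : Type*} [AddCommMonoid M] [Fintype D] (i : Fin (N + 1))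
    (f : (Fin (N + 1) → D) → M) :
    ∑ s, f s = ∑ x, ∑ t : Fin N → D, f (i.insertNth x t) := by
  rw [← Equiv.sum_comp (Fin.insertNthEquiv (fun _ => D) i), Fintype.sum_prod_type]
  rfl

theorem norm_add_sq_complex (a b : ℂ) :
    ‖a + b‖ ^ 2 = ‖a‖ ^ 2 + ‖b‖ ^ 2 + 2 * (a * star b).re := by
  rw [← Complex.normSq_eq_norm_sq, ← Complex.normSq_eq_norm_sq, ← Complex.normSq_eq_norm_sq,
    Complex.normSq_add]
  rfl

/-- For traceless `X` the summands of `collective X` are orthogonal, so that its squared Frobenius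
norm grows only linearly in `N`, relative to the dimension. -/
theorem card_mul_sum_norm_sq_collective [Fintype D] {X : Matrix D D ℂ} (hX : X.trace = 0) (N : ℕ) :
    Fintype.card D * ∑ s, ∑ t, ‖collective (N := N) X s t‖ ^ 2
      = N * (Fintype.card D : ℝ) ^ N * ∑ x, ∑ y, ‖X x y‖ ^ 2 := by
  induction N with
  | zero => simp [collective]
  | succ N ih =>
    have h1 : ∑ s, ∑ t, ‖collective (N := N + 1) X s t‖ ^ 2
        = ∑ x : D, ∑ s : Fin N → D, ∑ y : D, ∑ t : Fin N → D,
          ((if s = t then ‖X x y‖ ^ 2 else 0) + (if x = y then ‖collective X s t‖ ^ 2 else 0)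
            + if s = t then if x = y then 2 * (X x x * star (collective X s s)).re else 0
              else 0) := by
      rw [sum_insertNth 0]
      refine Finset.sum_congr rfl fun x _ => Finset.sum_congr rfl fun s _ => ?_
      rw [sum_insertNth 0]
      refine Finset.sum_congr rfl fun y _ => Finset.sum_congr rfl fun t _ => ?_
      rw [collective_insertNth, norm_add_sq_complex]
      by_cases h : s = t <;> by_cases h' : x = y <;> simp [h, h']
    have h2 : ∑ x : D, ∑ s : Fin N → D, 2 * (X x x * star (collective X s s)).re = 0 := by
      have : ((∑ x, X x x) * ∑ s : Fin N → D, star (collective X s s)).re = 0 := by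
        have : ∑ x, X x x = 0 := hX
        rw [this]; simp
      rw [Finset.sum_mul_sum, Complex.re_sum] at this
      simp_rw [Complex.re_sum] at this
      simp_rw [← Finset.mul_sum]
      rw [this, mul_zero]
    rw [h1]
    simp only [Finset.sum_add_distrib, Finset.sum_ite_eq, Finset.mem_univ, if_true]
    rw [h2, add_zero]
    have h3 : ∀ x : D, ∑ s : Fin N → D, ∑ y : D, ∑ t : Fin N → D,
        (if x = y then ‖collective X s t‖ ^ 2 else 0)
        = ∑ s : Fin N → D, ∑ t : Fin N → D, ‖collective X s t‖ ^ 2 := by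
      intro x
      refine Finset.sum_congr rfl fun s _ => ?_
      rw [Finset.sum_comm]
      simp
    simp only [h3, Finset.sum_const, Finset.card_univ, nsmul_eq_mul, Fintype.card_pi,
      Fintype.card_fin, Finset.prod_const, ← Finset.mul_sum]
    rw [mul_add, ih]
    push_cast
    ring

/-- The operator `1 ⊗ collective X - Xᵀ ⊗ 1` on an input register and `N + 1` ports. It is the
infinitesimal form of the symmetry `Ū ⊗ U ⊗ ⋯ ⊗ U` and annihilates maximally entangled pairs, so
that next to such a pair of the input and a port it acts on the other ports only. -/
def linkOp (X : Matrix D D ℂ) :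
    Matrix (D × (Fin (N + 1) → D)) (D × (Fin (N + 1) → D)) ℂ :=
  Matrix.of fun z z' => (if z.1 = z'.1 then collective X z.2 z'.2 else 0)
    - if z.2 = z'.2 then X z'.1 z.1 else 0

/-- The embedding of `N` registers into an input register and `N + 1` ports that adjoins the
unnormalized maximally entangled state `∑ₓ |x⟩ ⊗ |x⟩` of the input and the `i`-th port. -/
def portEmbedding (i : Fin (N + 1)) : Matrix (D × (Fin (N + 1) → D)) (Fin N → D) ℂ :=
  Matrix.of fun z t => if z.2 = i.insertNth z.1 t then 1 else 0

theorem linkOp_conjTranspose (X : Matrix D D ℂ) : (linkOp (N := N) X)ᴴ = linkOp Xᴴ := by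
  ext z z'
  have h := fun s t => congrFun (congrFun (collective_conjTranspose (N := N + 1) X) s) t
  simp only [Matrix.conjTranspose_apply] at h
  simp only [linkOp, Matrix.of_apply, Matrix.conjTranspose_apply, star_sub, apply_ite star,
    star_zero, h, eq_comm]

variable [Fintype D]

theorem linkOp_mul_portEmbedding (X : Matrix D D ℂ) (i : Fin (N + 1)) :
    linkOp (N := N) X * portEmbedding (D := D) i
      = portEmbedding (D := D) i * collective (N := N) X := by
  ext ⟨x, s⟩ t
  obtain ⟨y, s, rfl⟩ : ∃ y s', s = i.insertNth y s' :=
    ⟨s i, i.removeNth s, (Fin.insertNth_self_removeNth i s).symm⟩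
  rw [Matrix.mul_apply, Matrix.mul_apply, Fintype.sum_prod_type]
  simp only [linkOp, portEmbedding, Matrix.of_apply, mul_ite, mul_one, mul_zero,
    Finset.sum_ite_eq', Finset.mem_univ, if_true, Fin.insertNth_inj, ite_mul, one_mul,
    zero_mul, collective_insertNth, Finset.sum_sub_distrib, Finset.sum_ite_eq]
  by_cases h : y = x <;> by_cases h' : s = t <;> simp [h, h']

theorem portEmbedding_conjTranspose_mulVec (i : Fin (N + 1)) (w : D × (Fin (N + 1) → D) → ℂ)
    (t : Fin N → D) :
    ((portEmbedding i)ᴴ *ᵥ w) t = ∑ x, w (x, i.insertNth x t) := by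
  simp only [Matrix.mulVec, dotProduct, Fintype.sum_prod_type, portEmbedding,
    Matrix.conjTranspose_apply, Matrix.of_apply, apply_ite star, star_one, star_zero, ite_mul,
    one_mul, zero_mul, Finset.sum_ite_eq', Finset.mem_univ, if_true]

/-- The traceless part of the matrix unit `|a⟩⟨b|`. -/
def tracelessUnit (p : D × D) : Matrix D D ℂ :=
  Matrix.single p.1 p.2 1 - (if p.1 = p.2 then (Fintype.card D : ℂ)⁻¹ else 0) • 1

theorem trace_tracelessUnit [Nonempty D] (p : D × D) : (tracelessUnit p).trace = 0 := by
  obtain ⟨a, b⟩ := p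
  have : (Fintype.card D : ℂ) ≠ 0 := by exact_mod_cast Fintype.card_ne_zero
  by_cases h : a = b
  · subst h
    simp [tracelessUnit, Matrix.trace_sub, Matrix.trace_single_eq_same, this]
  · simp [tracelessUnit, h, Matrix.trace_single_eq_of_ne]

end

/-! ### Exact port-based teleportation -/

section

variable {D : Type*} [DecidableEq D] [Fintype D] {N : ℕ}

theorem sum_star_mul_collective_single (w : D × (Fin (N + 1) → D) → ℂ)
    (s t : Fin (N + 1) → D) :
    ∑ a, ∑ b, star (w (a, s)) * (collective (Matrix.single a b 1) s t * w (b, t))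
      = ∑ k, if ∀ j, j ≠ k → s j = t j then star (w (s k, s)) * w (t k, t) else 0 := by
  simp only [collective, Matrix.of_apply, Finset.sum_mul, Finset.mul_sum]
  have h1 : ∀ a, ∑ b, ∑ k, star (w (a, s)) * ((if ∀ j, j ≠ k → s j = t j then
        (Matrix.single a b (1 : ℂ)) (s k) (t k) else 0) * w (b, t))
      = ∑ k, ∑ b, star (w (a, s)) * ((if ∀ j, j ≠ k → s j = t j then
        (Matrix.single a b (1 : ℂ)) (s k) (t k) else 0) * w (b, t)) :=
    fun a => Finset.sum_comm
  simp_rw [h1]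
  rw [Finset.sum_comm]
  refine Finset.sum_congr rfl fun k _ => ?_
  by_cases h : ∀ j, j ≠ k → s j = t j
  · simp only [if_pos h, Matrix.single_apply]
    rw [Finset.sum_eq_single (s k), Finset.sum_eq_single (t k)]
    · simp
    · intro b _ hb; simp [hb]
    · simp
    · intro a _ ha; simp [ha]
    · simp
  · simp [if_neg h]

/-- The sum over the ports of the (unnormalized) projections onto the maximally entangled states of
input and port is `∑ |a⟩⟨b| ⊗ collective |a⟩⟨b|`. -/
theorem sum_norm_sq_portEmbedding (w : D × (Fin (N + 1) → D) → ℂ) :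
    ((∑ i : Fin (N + 1), ∑ t, ‖((portEmbedding (D := D) i)ᴴ *ᵥ w) t‖ ^ 2 : ℝ) : ℂ)
      = ∑ s, ∑ a, ∑ b, star (w (a, s)) *
          ∑ t, collective (Matrix.single a b 1) s t * w (b, t) := by
  have h0 : ∀ s : Fin (N + 1) → D, ∑ a, ∑ b, star (w (a, s)) *
      ∑ t, collective (Matrix.single a b 1) s t * w (b, t)
      = ∑ t, ∑ k, if ∀ j, j ≠ k → s j = t j then star (w (s k, s)) * w (t k, t) else 0 := by
    intro s
    simp_rw [← sum_star_mul_collective_single, Finset.mul_sum]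
    symm
    rw [Finset.sum_comm]
    refine Finset.sum_congr rfl fun a _ => ?_
    rw [Finset.sum_comm]
  simp_rw [h0]
  have h1 : ∀ s : Fin (N + 1) → D,
      (∑ t, ∑ k, if ∀ j, j ≠ k → s j = t j then star (w (s k, s)) * w (t k, t) else 0)
      = ∑ k, ∑ t, if ∀ j, j ≠ k → s j = t j then star (w (s k, s)) * w (t k, t) else 0 :=
    fun s => Finset.sum_comm
  simp_rw [h1]
  rw [Complex.ofReal_sum]
  conv_rhs => rw [Finset.sum_comm]
  refine Finset.sum_congr rfl fun k _ => ?_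
  rw [sum_insertNth k, Finset.sum_comm, Complex.ofReal_sum]
  refine Finset.sum_congr rfl fun u _ => ?_
  have h2 : ∀ x, (∑ t : Fin (N + 1) → D,
      if ∀ j, j ≠ k → (k.insertNth x u : Fin (N + 1) → D) j = t j then
        star (w ((k.insertNth x u : Fin (N + 1) → D) k, k.insertNth x u)) * w (t k, t) else 0)
      = ∑ y, star (w (x, k.insertNth x u)) * w (y, k.insertNth y u) := by
    intro x
    rw [sum_insertNth k]
    refine Finset.sum_congr rfl fun y _ => ?_
    simp only [forall_ne_insertNth_eq_iff, Fin.insertNth_apply_same, Finset.sum_ite_eq,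
      Finset.mem_univ, if_true]
  simp_rw [h2]
  rw [portEmbedding_conjTranspose_mulVec, ← Finset.sum_mul_sum, ← star_sum, ← starRingEnd_apply,
    Complex.conj_mul']
  push_cast
  rfl

theorem linkOp_tracelessUnit_mulVec (w : D × (Fin (N + 1) → D) → ℂ) (a b : D)
    (s : Fin (N + 1) → D) :
    (linkOp (tracelessUnit (a, b)) *ᵥ w) (b, s)
      = ∑ t, collective (Matrix.single a b 1) s t * w (b, t) - w (a, s)
        - if a = b then (N : ℂ) * (Fintype.card D : ℂ)⁻¹ * w (b, s) else 0 := by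
  have h1 : (linkOp (tracelessUnit (a, b)) *ᵥ w) (b, s)
      = ∑ t, collective (tracelessUnit (a, b)) s t * w (b, t)
        - ∑ y, tracelessUnit (a, b) y b * w (y, s) := by
    simp only [Matrix.mulVec, dotProduct, Fintype.sum_prod_type, linkOp, Matrix.of_apply, sub_mul,
      ite_mul, zero_mul, Finset.sum_sub_distrib, Finset.sum_ite_eq, Finset.mem_univ, if_true]
    congr 1
    rw [Finset.sum_comm]
    simp
  rw [h1, tracelessUnit, collective_sub, collective_smul_one]
  simp only [Matrix.sub_apply, Matrix.smul_apply, Matrix.one_apply, Matrix.single_apply, sub_mul,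
    Finset.sum_sub_distrib, smul_eq_mul, mul_ite, mul_one, mul_zero, ite_mul, zero_mul, one_mul,
    Finset.sum_ite_eq, Finset.sum_ite_eq', Finset.mem_univ, if_true, and_true]
  by_cases h : a = b
  · simp [h]; ring
  · simp [h]

theorem re_star_mul_le {η : ℝ} (hη : 0 < η) (x y : ℂ) :
    (star x * y).re ≤ η / 2 * ‖x‖ ^ 2 + (2 * η)⁻¹ * ‖y‖ ^ 2 := by
  have h1 : (star x * y).re ≤ ‖x‖ * ‖y‖ := by
    refine (Complex.re_le_norm _).trans (le_of_eq ?_)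
    rw [norm_mul, norm_star]
  have h2 : η / 2 * ‖x‖ ^ 2 + (2 * η)⁻¹ * ‖y‖ ^ 2 - ‖x‖ * ‖y‖
      = (2 * η)⁻¹ * (η * ‖x‖ - ‖y‖) ^ 2 := by
    field_simp
    ring
  have : 0 ≤ (2 * η)⁻¹ * (η * ‖x‖ - ‖y‖) ^ 2 := by positivity
  linarith

/-- On vectors on which all `linkOp X` are small, the sum of the unnormalized
projections onto the maximally entangled states of input and port is at most `N / d` up to lower
order terms. -/
theorem sum_norm_sq_portEmbedding_le {η : ℝ} (hη : 0 < η) (w : D × (Fin (N + 1) → D) → ℂ) :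
    ∑ i : Fin (N + 1), ∑ t, ‖((portEmbedding (D := D) i)ᴴ *ᵥ w) t‖ ^ 2
      ≤ (Fintype.card D + N * (Fintype.card D : ℝ)⁻¹ + η / 2 * Fintype.card D) * ∑ z, ‖w z‖ ^ 2
        + (2 * η)⁻¹ * ∑ p, ∑ z, ‖(linkOp (tracelessUnit p) *ᵥ w) z‖ ^ 2 := by
  have hw : ∑ z, ‖w z‖ ^ 2 = ∑ s, ∑ a, ‖w (a, s)‖ ^ 2 := by
    rw [Fintype.sum_prod_type, Finset.sum_comm]
  have hnorm : ∀ z : ℂ, star z * z = ((‖z‖ ^ 2 : ℝ) : ℂ) := by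
    intro z
    rw [← starRingEnd_apply, Complex.conj_mul']
    norm_cast
  -- The collective matrix units are the symmetry generators plus remainders which, in this sum, add
  -- up to a multiple of the identity.
  have hid : ((∑ i : Fin (N + 1), ∑ t, ‖((portEmbedding (D := D) i)ᴴ *ᵥ w) t‖ ^ 2 : ℝ) : ℂ)
      = ∑ s, ∑ a, ∑ b, star (w (a, s)) * (linkOp (tracelessUnit (a, b)) *ᵥ w) (b, s)
        + (((Fintype.card D + N * (Fintype.card D : ℝ)⁻¹) * ∑ z, ‖w z‖ ^ 2 : ℝ) : ℂ) := by
    rw [sum_norm_sq_portEmbedding, hw]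
    push_cast
    simp only [Finset.mul_sum, ← Finset.sum_add_distrib]
    refine Finset.sum_congr rfl fun s _ => Finset.sum_congr rfl fun a _ => ?_
    have h1 : ∀ b, star (w (a, s)) * (linkOp (tracelessUnit (a, b)) *ᵥ w) (b, s)
        = star (w (a, s)) * ∑ t, collective (Matrix.single a b 1) s t * w (b, t)
          - star (w (a, s)) * w (a, s)
          - if a = b then (N : ℂ) * (Fintype.card D : ℂ)⁻¹ * (star (w (a, s)) * w (a, s))
            else 0 := by
      intro b
      rw [linkOp_tracelessUnit_mulVec]
      by_cases h : a = b
      · subst h; simp; ring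
      · simp [h]; ring
    simp_rw [h1]
    rw [Finset.sum_sub_distrib, Finset.sum_sub_distrib]
    simp only [Finset.sum_const, Finset.card_univ, nsmul_eq_mul, Finset.sum_ite_eq,
      Finset.mem_univ, if_true, hnorm, Finset.mul_sum]
    push_cast
    ring
  have hre := congrArg Complex.re hid
  rw [Complex.ofReal_re, Complex.add_re, Complex.ofReal_re] at hre
  have hle : (∑ s, ∑ a, ∑ b, star (w (a, s)) *
        (linkOp (tracelessUnit (a, b)) *ᵥ w) (b, s)).re
      ≤ η / 2 * Fintype.card D * ∑ z, ‖w z‖ ^ 2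
        + (2 * η)⁻¹ * ∑ p, ∑ z, ‖(linkOp (tracelessUnit p) *ᵥ w) z‖ ^ 2 := by
    have h2 : ∑ s, ∑ a, ∑ b, ‖(linkOp (tracelessUnit (a, b)) *ᵥ w) (b, s)‖ ^ 2
        ≤ ∑ p, ∑ z, ‖(linkOp (tracelessUnit p) *ᵥ w) z‖ ^ 2 := by
      rw [Finset.sum_comm, Fintype.sum_prod_type]
      refine Finset.sum_le_sum fun a _ => ?_
      rw [Finset.sum_comm]
      refine Finset.sum_le_sum fun b _ => ?_
      rw [Fintype.sum_prod_type]
      exact Finset.single_le_sum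
        (f := fun y => ∑ s, ‖(linkOp (tracelessUnit (a, b)) *ᵥ w) (y, s)‖ ^ 2)
        (fun y _ => by positivity) (Finset.mem_univ b)
    calc _ = ∑ s, ∑ a, ∑ b, (star (w (a, s)) *
          (linkOp (tracelessUnit (a, b)) *ᵥ w) (b, s)).re := by simp only [Complex.re_sum]
      _ ≤ ∑ s, ∑ a, ∑ b, (η / 2 * ‖w (a, s)‖ ^ 2
          + (2 * η)⁻¹ * ‖(linkOp (tracelessUnit (a, b)) *ᵥ w) (b, s)‖ ^ 2) :=
        Finset.sum_le_sum fun s _ => Finset.sum_le_sum fun a _ => Finset.sum_le_sum fun b _ =>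
          re_star_mul_le hη _ _
      _ = η / 2 * Fintype.card D * ∑ z, ‖w z‖ ^ 2 + (2 * η)⁻¹ *
          ∑ s, ∑ a, ∑ b, ‖(linkOp (tracelessUnit (a, b)) *ᵥ w) (b, s)‖ ^ 2 := by
        simp only [Finset.sum_add_distrib, Finset.sum_const, Finset.card_univ, nsmul_eq_mul,
          ← Finset.mul_sum, hw]
        ring
      _ ≤ _ := by gcongr
  rw [hre]
  linarith

theorem sum_norm_sq_tracelessUnit_le [Nonempty D] :
    ∑ p : D × D, ∑ x, ∑ y, ‖tracelessUnit p x y‖ ^ 2 ≤ (Fintype.card D : ℝ) ^ 2 := by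
  have hd : (1 : ℝ) ≤ Fintype.card D := by exact_mod_cast Fintype.card_pos
  have hd' : (Fintype.card D : ℝ) ≠ 0 := by positivity
  have key : ∀ p : D × D, ∑ x, ∑ y, ‖tracelessUnit p x y‖ ^ 2 ≤ 1 := by
    rintro ⟨a, b⟩
    have h0 : ∀ x y, tracelessUnit (a, b) x y = (if a = x ∧ b = y then 1 else 0)
        - if a = b then if x = y then (Fintype.card D : ℂ)⁻¹ else 0 else 0 := by
      intro x y
      by_cases hab : a = b <;>
        simp [tracelessUnit, Matrix.single_apply, Matrix.one_apply, hab]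
    have h1 : ∀ x y, ‖tracelessUnit (a, b) x y‖ ^ 2
        = (if b = y then if a = x then 1 else 0 else 0)
          + if a = b then if x = y then ((Fintype.card D : ℝ)⁻¹ ^ 2
            - if a = x then 2 * (Fintype.card D : ℝ)⁻¹ else 0) else 0 else 0 := by
      intro x y
      have e1 : ‖(1 : ℂ) - (Fintype.card D : ℂ)⁻¹‖ ^ 2
          = 1 + ((Fintype.card D : ℝ)⁻¹ ^ 2 - 2 * (Fintype.card D : ℝ)⁻¹) := by
        have : (1 : ℂ) - (Fintype.card D : ℂ)⁻¹ = ((1 - (Fintype.card D : ℝ)⁻¹ : ℝ) : ℂ) := by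
          push_cast; rfl
        rw [this, Complex.norm_real, Real.norm_eq_abs, sq_abs]
        ring
      rw [h0]
      by_cases hab : a = b
      · subst hab
        by_cases hx : a = x
        · subst hx
          by_cases hy : a = y
          · subst hy; simpa using e1
          · simp [hy]
        · by_cases hxy : x = y
          · subst hxy; simp [hx]
          · simp [hx, hxy]
      · simp only [if_neg hab]
        by_cases hx : a = x <;> by_cases hy : b = y <;> simp [hx, hy]
    simp_rw [h1]
    simp only [Finset.sum_add_distrib, Finset.sum_ite_eq, Finset.mem_univ, if_true]
    by_cases hab : a = b
    · simp only [hab, if_true, Finset.sum_ite_eq, Finset.mem_univ, Finset.sum_sub_distrib,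
        Finset.sum_const, Finset.card_univ, nsmul_eq_mul]
      have : (Fintype.card D : ℝ) * (Fintype.card D : ℝ)⁻¹ ^ 2 = (Fintype.card D : ℝ)⁻¹ := by
        field_simp
      rw [this]
      have : 0 ≤ (Fintype.card D : ℝ)⁻¹ := by positivity
      linarith
    · simp [hab]
  calc _ ≤ ∑ p : D × D, (1 : ℝ) := Finset.sum_le_sum fun p _ => key p
    _ = _ := by simp [sq]

/-- **Exact port-based teleportation with maximally entangled ports.** With enough ports there is a
measurement on the input and the near halves of the ports with the following property: outcome `i`
leaves the input state exactly in the `i`-th port, and some outcome `i` occurs with probability at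
least `1 - ε`. The outcome `i` has the measurement operator `T (Ψ i)†`, where `T` acts on the other
ports, and the two claims are that these operators can be completed to a measurement, and that
their success probability `(N + 1) ‖T‖² / d ^ (N + 1)` is large. -/
theorem exists_portBasedTeleportation (D : Type*) [DecidableEq D] [Fintype D] [Nonempty D] {ε : ℝ}
    (hε : 0 < ε) : ∃ (N : ℕ) (T : Matrix (Fin N → D) (Fin N → D) ℂ),
      (∀ v : D × (Fin (N + 1) → D) → ℂ,
        ∑ i : Fin (N + 1), ∑ t, ‖((T * (portEmbedding (D := D) i)ᴴ) *ᵥ v) t‖ ^ 2 ≤ ∑ z, ‖v z‖ ^ 2) ∧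
      (1 - ε) * (Fintype.card D : ℝ) ^ (N + 1) ≤ (N + 1) * ∑ s, ∑ t, ‖T s t‖ ^ 2 := by
  wlog hε1 : ε ≤ 1 generalizing ε
  · obtain ⟨N, T, h1, h2⟩ := this one_pos le_rfl
    refine ⟨N, T, h1, le_trans ?_ h2⟩
    have : (1 - ε) ≤ 1 - 1 := by linarith
    gcongr
  obtain ⟨d, hd⟩ : ∃ d : ℝ, d = Fintype.card D := ⟨_, rfl⟩
  have hd0 : 0 < d := by rw [hd]; exact_mod_cast Fintype.card_pos
  -- A large `η` lets the resolvent deviate little from `1` on typical states: the loss is `ε / 2`.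
  -- The other half of `ε` pays for the lower order terms of `β`.
  obtain ⟨η, hη⟩ : ∃ η : ℝ, η = d ^ 2 / ε := ⟨_, rfl⟩
  have hη0 : 0 < η := by rw [hη]; positivity
  obtain ⟨N, hN⟩ := exists_nat_ge (2 * (d ^ 2 + η / 2 * d ^ 2) / ε)
  obtain ⟨β, hβ⟩ : ∃ β : ℝ, β = d + N * d⁻¹ + η / 2 * d := ⟨_, rfl⟩
  have hβ0 : 0 < β := by rw [hβ]; positivity
  -- For this value, `β` times the weight `2 c` of `‖L w‖²` in the bound for the resolvent is its
  -- weight `(2 η)⁻¹` in the bound for the projections.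
  obtain ⟨c, hc⟩ : ∃ c : ℝ, c = (4 * η * β)⁻¹ := ⟨_, rfl⟩
  have hc0 : 0 ≤ c := by rw [hc]; positivity
  let F : D × D → Matrix (Fin N → D) (Fin N → D) ℂ := fun p => collective (tracelessUnit p)
  let L : D × D → Matrix (D × (Fin (N + 1) → D)) (D × (Fin (N + 1) → D)) ℂ :=
    fun p => linkOp (tracelessUnit p)
  have hinter : ∀ i : Fin (N + 1),
      gramResolvent c F * (portEmbedding (D := D) i)ᴴ
        = (portEmbedding (D := D) i)ᴴ * gramResolvent c L := by
    intro i
    have h := gramResolvent_mul_of_intertwining (L := L) (F := F) hc0 (portEmbedding (D := D) i)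
      (fun p => linkOp_mul_portEmbedding _ i) (fun p => by
        simp only [L, F, linkOp_conjTranspose, collective_conjTranspose]
        exact linkOp_mul_portEmbedding _ i)
    have h' := congrArg Matrix.conjTranspose h
    rw [Matrix.conjTranspose_mul, Matrix.conjTranspose_mul, (isHermitian_gramResolvent hc0 L).eq,
      (isHermitian_gramResolvent hc0 F).eq] at h'
    exact h'.symm
  have hsqrt : ‖((Real.sqrt β⁻¹ : ℝ) : ℂ)‖ ^ 2 = β⁻¹ := by
    rw [Complex.norm_real, Real.norm_eq_abs, sq_abs, Real.sq_sqrt (by positivity)]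
  refine ⟨N, ((Real.sqrt β⁻¹ : ℝ) : ℂ) • gramResolvent c F, fun v => ?_, ?_⟩
  · obtain ⟨w, hw⟩ : ∃ w, w = gramResolvent c L *ᵥ v := ⟨_, rfl⟩
    have h1 : ∑ i : Fin (N + 1), ∑ t, ‖((((Real.sqrt β⁻¹ : ℝ) : ℂ) • gramResolvent c F *
        (portEmbedding (D := D) i)ᴴ) *ᵥ v) t‖ ^ 2
        = β⁻¹ * ∑ i : Fin (N + 1), ∑ t, ‖((portEmbedding (D := D) i)ᴴ *ᵥ w) t‖ ^ 2 := by
      simp only [Matrix.smul_mul, hinter, Matrix.smul_mulVec, Pi.smul_apply, smul_eq_mul, norm_mul,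
        mul_pow, hsqrt, ← Finset.mul_sum, ← Matrix.mulVec_mulVec, hw]
    have h2 := sum_norm_sq_portEmbedding_le hη0 w
    have h3 := sum_norm_sq_gramResolvent_add_le hc0 L v
    rw [← hd, ← hβ] at h2
    rw [← hw] at h3
    have h4 : (2 * η)⁻¹ = β * (2 * c) := by rw [hc]; field_simp; norm_num
    rw [h1, inv_mul_le_iff₀ hβ0]
    calc _ ≤ _ := h2
      _ = β * (∑ z, ‖w z‖ ^ 2 + 2 * c * ∑ p, ∑ z, ‖(L p *ᵥ w) z‖ ^ 2) := by
        rw [h4]; ring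
      _ ≤ _ := by gcongr
  · have h1 : ∑ s, ∑ t, ‖(((Real.sqrt β⁻¹ : ℝ) : ℂ) • gramResolvent c F) s t‖ ^ 2
        = β⁻¹ * ∑ s, ∑ t, ‖gramResolvent c F s t‖ ^ 2 := by
      simp only [Matrix.smul_apply, smul_eq_mul, norm_mul, mul_pow, hsqrt, ← Finset.mul_sum]
    have h2 := le_sum_norm_sq_gramResolvent_entries hc0 F
    have h3 : d * ∑ p, ∑ s, ∑ t, ‖F p s t‖ ^ 2 ≤ N * d ^ N * d ^ 2 := by
      rw [Finset.mul_sum]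
      have : ∀ p, d * ∑ s, ∑ t, ‖F p s t‖ ^ 2
          = N * d ^ N * ∑ x, ∑ y, ‖tracelessUnit p x y‖ ^ 2 := by
        intro p
        rw [hd]
        exact card_mul_sum_norm_sq_collective (trace_tracelessUnit p) N
      simp_rw [this]
      rw [← Finset.mul_sum]
      gcongr
      rw [hd]
      exact sum_norm_sq_tracelessUnit_le
    have hcard : (Fintype.card (Fin N → D) : ℝ) = d ^ N := by
      rw [Fintype.card_pi, hd]; simp
    rw [hcard] at h2
    rw [h1, ← hd]
    have hNβ : N ≤ d * β := by
      have : d * β = N + (d ^ 2 + η / 2 * d ^ 2) := by rw [hβ]; field_simp; ring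
      rw [this]
      have : 0 ≤ d ^ 2 + η / 2 * d ^ 2 := by positivity
      linarith
    have h4 : 2 * c * ∑ p, ∑ s, ∑ t, ‖F p s t‖ ^ 2 ≤ ε / 2 * d ^ N := by
      have h5 : ∑ p, ∑ s, ∑ t, ‖F p s t‖ ^ 2 ≤ N * d ^ N * d := by
        rw [← mul_le_mul_iff_right₀ hd0]
        calc _ ≤ _ := h3
          _ = _ := by ring
      calc 2 * c * ∑ p, ∑ s, ∑ t, ‖F p s t‖ ^ 2 ≤ 2 * c * (d * β * d ^ N * d) := by
            refine mul_le_mul_of_nonneg_left (h5.trans ?_) (by positivity)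
            gcongr
        _ = ε / 2 * d ^ N := by rw [hc, hη]; field_simp; norm_num
    have h6 : (1 - ε / 2) * d ^ N ≤ ∑ s, ∑ t, ‖gramResolvent c F s t‖ ^ 2 := by linarith
    have h7 : (1 - ε / 2) * (d * β) ≤ N + 1 := by
      have e1 : d * β = N + (d ^ 2 + η / 2 * d ^ 2) := by rw [hβ]; field_simp; ring
      have e2 : 2 * (d ^ 2 + η / 2 * d ^ 2) ≤ N * ε := (div_le_iff₀ hε).1 hN
      have e3 : 0 ≤ ε / 2 * (d ^ 2 + η / 2 * d ^ 2) := by positivity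
      rw [e1]
      nlinarith
    have h8 : (1 - ε / 2) * d ≤ (N + 1) * β⁻¹ := by
      rw [← div_eq_mul_inv, le_div_iff₀ hβ0]
      linarith
    have h9 : 0 ≤ 1 - ε / 2 := by linarith
    calc (1 - ε) * d ^ (N + 1) ≤ (1 - ε / 2) ^ 2 * d ^ (N + 1) := by
          gcongr; nlinarith [sq_nonneg ε]
      _ = ((1 - ε / 2) * d) * ((1 - ε / 2) * d ^ N) := by ring
      _ ≤ ((N + 1) * β⁻¹) * ∑ s, ∑ t, ‖gramResolvent c F s t‖ ^ 2 := by gcongr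
      _ = _ := by ring

end

/-! ### Bell measurements and selection of a register -/

section

variable {G : Type*} [AddCommGroup G] [Fintype G] [DecidableEq G]

/-- The generalized Pauli operators `|y⟩ ↦ χ(y) |y + u⟩` of a finite abelian group. -/
def weyl (p : G × AddChar G ℂ) : Matrix G G ℂ :=
  Matrix.of fun x y => if x = y + p.1 then p.2 y else 0

theorem addChar_star_mul {G : Type*} [AddCommGroup G] [Fintype G] (χ : AddChar G ℂ)
    (y y' : G) : star (χ y) * χ y' = χ (y' - y) := by
  rw [← starRingEnd_apply, ← AddChar.map_neg_eq_conj, ← AddChar.map_add_eq_mul]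
  congr 1
  abel

theorem weyl_mem_unitaryGroup (p : G × AddChar G ℂ) : weyl p ∈ Matrix.unitaryGroup G ℂ := by
  rw [Matrix.mem_unitaryGroup_iff', Matrix.star_eq_conjTranspose]
  ext y y'
  simp only [Matrix.mul_apply, Matrix.conjTranspose_apply, weyl, Matrix.of_apply, apply_ite star,
    star_zero, ite_mul, zero_mul, Finset.sum_ite_eq', Finset.mem_univ, if_true, mul_ite,
    mul_zero, add_left_inj, Matrix.one_apply]
  by_cases h : y = y'
  · subst h
    rw [if_pos rfl, if_pos rfl, addChar_star_mul, sub_self, AddChar.map_zero_eq_one]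
  · rw [if_neg h, if_neg (Ne.symm h)]

/-- The measurement in the Bell basis: the generalized Pauli operators are an orthogonal basis of
the space of all matrices. -/
theorem sum_star_weyl_mul_weyl (x y x' y' : G) :
    ∑ p, star (weyl p x y) * weyl p x' y'
      = if x = x' ∧ y = y' then (Fintype.card G : ℂ) else 0 := by
  rw [Fintype.sum_prod_type]
  have h1 : ∀ u : G, ∑ χ : AddChar G ℂ, star (weyl (u, χ) x y) * weyl (u, χ) x' y'
      = if x - y = u then if x' - y' = u then if y = y' then (Fintype.card G : ℂ) else 0 else 0
        else 0 := by
    intro u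
    have e1 : ∀ a b : G, a = b + u ↔ a - b = u := fun a b => by
      rw [sub_eq_iff_eq_add, add_comm]
    simp only [weyl, Matrix.of_apply, e1]
    by_cases hx : x - y = u
    · by_cases hx' : x' - y' = u
      · simp only [hx, hx', if_true, addChar_star_mul, AddChar.sum_apply_eq_ite, sub_eq_zero]
        simp [eq_comm]
      · simp [hx, hx']
    · simp [hx]
  simp only [h1, Finset.sum_ite_eq, Finset.mem_univ, if_true]
  by_cases hy : y = y'
  · subst hy
    simp [eq_comm]
  · simp [hy]

/-- The factor `|G|^(-1/2)` that normalizes a maximally entangled state. -/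
def invSqrtCard (G : Type*) [Fintype G] : ℂ :=
  ((Real.sqrt (Fintype.card G))⁻¹ : ℝ)

theorem norm_invSqrtCard_sq (G : Type*) [Fintype G] :
    ‖invSqrtCard G‖ ^ 2 = (Fintype.card G : ℝ)⁻¹ := by
  rw [invSqrtCard, Complex.norm_real, Real.norm_eq_abs, sq_abs, inv_pow,
    Real.sq_sqrt (Nat.cast_nonneg _)]

theorem star_invSqrtCard (G : Type*) [Fintype G] : star (invSqrtCard G) = invSqrtCard G := by
  rw [invSqrtCard, ← starRingEnd_apply, Complex.conj_ofReal]

theorem invSqrtCard_mul_self (G : Type*) [Fintype G] :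
    invSqrtCard G * invSqrtCard G = (Fintype.card G : ℂ)⁻¹ := by
  rw [invSqrtCard, ← Complex.ofReal_mul, ← mul_inv, Real.mul_self_sqrt (Nat.cast_nonneg _)]
  push_cast
  rfl

/-- The normalized Bell basis. -/
def bell (p : G × AddChar G ℂ) : Matrix G G ℂ := invSqrtCard G • weyl p

theorem sum_star_bell_mul_bell (x y x' y' : G) :
    ∑ p, star (bell p x y) * bell p x' y' = if x = x' ∧ y = y' then 1 else 0 := by
  have h0 : (Fintype.card G : ℂ) ≠ 0 := by
    have : Nonempty G := ⟨0⟩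
    exact_mod_cast Fintype.card_ne_zero
  have h1 : ∀ p : G × AddChar G ℂ, star (bell p x y) * bell p x' y'
      = (Fintype.card G : ℂ)⁻¹ * (star (weyl p x y) * weyl p x' y') := by
    intro p
    rw [← invSqrtCard_mul_self, bell, Matrix.smul_apply, Matrix.smul_apply, smul_eq_mul,
      smul_eq_mul, star_mul', star_invSqrtCard]
    ring
  simp_rw [h1]
  rw [← Finset.mul_sum, sum_star_weyl_mul_weyl]
  split_ifs <;> simp [h0]

end

theorem sum_norm_sq_of_orthonormal {Out In Post : Type*} [Fintype Out] [Fintype In]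
    [DecidableEq In] [Fintype Post] (op : Out → Post → In → ℂ)
    (h : ∀ x x', ∑ o, ∑ k, star (op o k x) * op o k x' = if x = x' then 1 else 0) (v : In → ℂ) :
    ∑ o, ∑ k, ‖∑ x, v x * op o k x‖ ^ 2 = ∑ x, ‖v x‖ ^ 2 := by
  have hnorm : ∀ z : ℂ, ((‖z‖ ^ 2 : ℝ) : ℂ) = star z * z := by
    intro z
    rw [← starRingEnd_apply, Complex.conj_mul']
    norm_cast
  have : ((∑ o, ∑ k, ‖∑ x, v x * op o k x‖ ^ 2 : ℝ) : ℂ) = ((∑ x, ‖v x‖ ^ 2 : ℝ) : ℂ) := by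
    rw [Complex.ofReal_sum, Complex.ofReal_sum]
    simp_rw [Complex.ofReal_sum, hnorm, star_sum, Finset.sum_mul_sum]
    have h1 : ∀ x x', ∑ o, ∑ k, star (v x * op o k x) * (v x' * op o k x')
        = if x = x' then star (v x) * v x' else 0 := by
      intro x x'
      calc _ = star (v x) * v x' * ∑ o, ∑ k, star (op o k x) * op o k x' := by
            simp_rw [Finset.mul_sum]
            refine Finset.sum_congr rfl fun o _ => Finset.sum_congr rfl fun k _ => ?_
            rw [star_mul']
            ring
        _ = _ := by rw [h]; simp
    calc ∑ o, ∑ k, ∑ x, ∑ x', star (v x * op o k x) * (v x' * op o k x')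
        = ∑ x, ∑ x', ∑ o, ∑ k, star (v x * op o k x) * (v x' * op o k x') := by
          have e1 : ∀ o, ∑ k, ∑ x, ∑ x', star (v x * op o k x) * (v x' * op o k x')
              = ∑ x, ∑ x', ∑ k, star (v x * op o k x) * (v x' * op o k x') := by
            intro o
            rw [Finset.sum_comm]
            exact Finset.sum_congr rfl fun x _ => Finset.sum_comm
          simp_rw [e1]
          rw [Finset.sum_comm]
          exact Finset.sum_congr rfl fun x _ => Finset.sum_comm
      _ = _ := by simp_rw [h1]; simp
  exact_mod_cast this

/-- Measuring all members of a finite family of systems in parallel. -/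
theorem sum_star_prod_mul_prod {ι Out In Post : Type*} [Fintype ι] [DecidableEq ι] [Fintype Out]
    [DecidableEq In] [Fintype Post] (op : Out → Post → In → ℂ)
    (h : ∀ x x', ∑ o, ∑ k, star (op o k x) * op o k x' = if x = x' then 1 else 0)
    (s s' : ι → In) :
    ∑ q : ι → Out, ∑ f : ι → Post, star (∏ l, op (q l) (f l) (s l)) * ∏ l, op (q l) (f l) (s' l)
      = if s = s' then 1 else 0 := by
  simp_rw [star_prod, ← Finset.prod_mul_distrib]
  have h1 : ∀ q : ι → Out, ∑ f : ι → Post, ∏ l, star (op (q l) (f l) (s l)) * op (q l) (f l) (s' l)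
      = ∏ l, ∑ k, star (op (q l) k (s l)) * op (q l) k (s' l) := fun q =>
    (Fintype.prod_sum fun l k => star (op (q l) k (s l)) * op (q l) k (s' l)).symm
  simp_rw [h1]
  rw [← Fintype.prod_sum fun l o => ∑ k, star (op o k (s l)) * op o k (s' l)]
  simp_rw [h]
  by_cases hs : s = s'
  · simp [hs]
  · obtain ⟨l, hl⟩ := Function.ne_iff.1 hs
    rw [if_neg hs]
    exact Finset.prod_eq_zero (Finset.mem_univ l) (if_neg hl)

/-- The operation that outputs the `i`-th of `N + 1` registers after a unitary `W` on it, and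
measures the other ones in the computational basis. -/
def selectOp {X : Type} [Fintype X] [DecidableEq X] {N : ℕ} (i : Fin (N + 1)) (W : Matrix X X ℂ)
    (hW : W ∈ Matrix.unitaryGroup X ℂ) :
    LocalOperation (Fin N → X) (Fin (N + 1) → X) X where
  op f := Matrix.of fun x s => if i.removeNth s = f then W x (s i) else 0
  complete := by
    rw [sum_op_conj_mul_eq_one_iff]
    intro s s'
    have hWW := fun y y' =>
      congrFun (congrFun (Matrix.mem_unitaryGroup_iff'.1 hW) y) y'
    simp only [Matrix.star_eq_conjTranspose, Matrix.mul_apply, Matrix.conjTranspose_apply,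
      Matrix.one_apply] at hWW
    have h1 : ∀ f : Fin N → X, ∑ x, star (if i.removeNth s = f then W x (s i) else 0) *
        (if i.removeNth s' = f then W x (s' i) else 0)
        = if i.removeNth s = f then if i.removeNth s' = f then if s i = s' i then 1 else 0 else 0
          else 0 := by
      intro f
      rw [← hWW]
      split_ifs <;> simp
    simp only [Matrix.of_apply, h1, Finset.sum_ite_eq, Finset.mem_univ, if_true]
    obtain ⟨x, u, rfl⟩ : ∃ x u, s = i.insertNth x u :=
      ⟨s i, i.removeNth s, (Fin.insertNth_self_removeNth i s).symm⟩
    obtain ⟨x', u', rfl⟩ : ∃ x u, s' = i.insertNth x u :=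
      ⟨s' i, i.removeNth s', (Fin.insertNth_self_removeNth i s').symm⟩
    simp only [Fin.removeNth_insertNth, Fin.insertNth_apply_same, Fin.insertNth_inj]
    by_cases hx : x = x' <;> by_cases hu : u = u' <;> simp [hx, hu, eq_comm]

theorem sum_selectOp_mul {X : Type} [Fintype X] [DecidableEq X] {N : ℕ} (i : Fin (N + 1))
    {W : Matrix X X ℂ} (hW : W ∈ Matrix.unitaryGroup X ℂ) (f : Fin N → X) (x : X)
    (g : (Fin (N + 1) → X) → ℂ) :
    ∑ s, (selectOp i W hW).op f x s * g s = ∑ x', W x x' * g (i.insertNth x' f) := by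
  rw [sum_insertNth i]
  refine Finset.sum_congr rfl fun x' _ => ?_
  simp [selectOp]

theorem posSemidef_one_sub_of_sum_norm_sq_le {Out In Post : Type*} [Fintype Out] [Fintype In]
    [DecidableEq In] [Fintype Post] (K : Out → Matrix Post In ℂ)
    (h : ∀ v : In → ℂ, ∑ o, ∑ k, ‖(K o *ᵥ v) k‖ ^ 2 ≤ ∑ x, ‖v x‖ ^ 2) :
    (1 - ∑ o, (K o)ᴴ * K o).PosSemidef := by
  have hH : (1 - ∑ o, (K o)ᴴ * K o).IsHermitian :=
    Matrix.isHermitian_one.sub (Matrix.posSemidef_sum _ fun o _ =>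
      Matrix.posSemidef_conjTranspose_mul_self (K o)).isHermitian
  refine Matrix.PosSemidef.of_dotProduct_mulVec_nonneg hH fun v => ?_
  have him : (star v ⬝ᵥ ((1 - ∑ o, (K o)ᴴ * K o) *ᵥ v)).im = 0 :=
    hH.im_star_dotProduct_mulVec_self v
  rw [Complex.nonneg_iff]
  refine ⟨?_, him.symm⟩
  rw [Matrix.sub_mulVec, Matrix.one_mulVec, dotProduct_sub, Complex.sub_re,
    re_star_dotProduct_self, Matrix.sum_mulVec, dotProduct_sum, Complex.re_sum]
  simp_rw [re_star_dotProduct_conjTranspose_mul_mulVec]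
  linarith [h v]

/-! ### The protocol -/

section

variable {X Y : Type} [AddCommGroup X] [Fintype X] [DecidableEq X]
  [AddCommGroup Y] [Fintype Y] [DecidableEq Y] {N : ℕ}

/-- Applying `V` to a register `X × Y`, keeping the `X`-part, and teleporting the `Y`-part: the
measurement operator for the outcome `q` of the Bell measurement of the `Y`-part and the near half
`s` of a maximally entangled state. -/
def sendBack (V : Matrix (X × Y) (X × Y) ℂ) (q : Y × AddChar Y ℂ) (κ : X) (z : (X × Y) × Y) : ℂ :=
  ∑ y, star (bell q y z.2) * V (κ, y) z.1

theorem sum_star_sendBack_mul_sendBack {X Y : Type} [Fintype X] [DecidableEq X]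
    [AddCommGroup Y] [Fintype Y] [DecidableEq Y] {V : Matrix (X × Y) (X × Y) ℂ}
    (hV : V ∈ Matrix.unitaryGroup (X × Y) ℂ) (z z' : (X × Y) × Y) :
    ∑ q, ∑ κ, star (sendBack V q κ z) * sendBack V q κ z' = if z = z' then 1 else 0 := by
  have hVV := congrFun (congrFun (Matrix.mem_unitaryGroup_iff'.1 hV) z.1) z'.1
  simp only [Matrix.star_eq_conjTranspose, Matrix.mul_apply, Matrix.conjTranspose_apply,
    Matrix.one_apply, Fintype.sum_prod_type (α₁ := X)] at hVV
  rw [Finset.sum_comm]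
  have h1 : ∀ κ, ∑ q, star (sendBack V q κ z) * sendBack V q κ z'
      = if z.2 = z'.2 then ∑ y, star (V (κ, y) z.1) * V (κ, y) z'.1 else 0 := by
    intro κ
    simp only [sendBack, star_sum, star_mul', star_star, Finset.sum_mul_sum]
    calc ∑ q, ∑ y, ∑ y', bell q y z.2 * star (V (κ, y) z.1) *
          (star (bell q y' z'.2) * V (κ, y') z'.1)
        = ∑ y, ∑ y', star (V (κ, y) z.1) * V (κ, y') z'.1 *
          ∑ q, star (bell q y' z'.2) * bell q y z.2 := by
          rw [Finset.sum_comm]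
          refine Finset.sum_congr rfl fun y _ => ?_
          rw [Finset.sum_comm]
          refine Finset.sum_congr rfl fun y' _ => ?_
          rw [Finset.mul_sum]
          exact Finset.sum_congr rfl fun q _ => by ring
      _ = _ := by
          simp_rw [sum_star_bell_mul_bell]
          by_cases hz : z.2 = z'.2
          · simp [hz]
          · simp [hz, Ne.symm hz]
  simp_rw [h1]
  by_cases hz : z.2 = z'.2
  · simp only [hz, if_true, hVV, Prod.ext_iff, and_true]
  · simp [hz, Prod.ext_iff]

/-- If the receiver of the `Y`-part corrects the Pauli error `q`, then `V` has been applied. -/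
theorem sum_weyl_mul_sendBack {X Y : Type} [AddCommGroup Y] [Fintype Y] [DecidableEq Y]
    (V : Matrix (X × Y) (X × Y) ℂ) (q : Y × AddChar Y ℂ) (κ : X) (η : Y)
    (z : X × Y) :
    ∑ σ, weyl q η σ * sendBack V q κ (z, σ) = invSqrtCard Y * V (κ, η) z := by
  have hW := fun y y' =>
    congrFun (congrFun (Matrix.mem_unitaryGroup_iff.1 (weyl_mem_unitaryGroup q)) y) y'
  simp only [Matrix.star_eq_conjTranspose, Matrix.mul_apply, Matrix.conjTranspose_apply,
    Matrix.one_apply] at hW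
  calc ∑ σ, weyl q η σ * sendBack V q κ (z, σ)
      = ∑ y, invSqrtCard Y * V (κ, y) z * ∑ σ, weyl q η σ * star (weyl q y σ) := by
        simp_rw [sendBack, Finset.mul_sum]
        rw [Finset.sum_comm]
        refine Finset.sum_congr rfl fun y _ => Finset.sum_congr rfl fun σ _ => ?_
        rw [bell, Matrix.smul_apply, smul_eq_mul, star_mul', star_invSqrtCard]
        ring
    _ = _ := by
        simp_rw [hW]
        simp

/-- The unitary that corrects the Pauli error `p` of a teleportation of the `X`-part and then
applies `U`. -/
def correctThenApply (U : Matrix (X × Y) (X × Y) ℂ) (p : X × AddChar X ℂ) :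
    Matrix (X × Y) (X × Y) ℂ :=
  U * ((weyl p)ᴴ ⊗ₖ (1 : Matrix Y Y ℂ))

theorem correctThenApply_mem_unitaryGroup {X Y : Type} [AddCommGroup X] [Fintype X]
    [DecidableEq X] [Fintype Y] [DecidableEq Y] {U : Matrix (X × Y) (X × Y) ℂ}
    (hU : U ∈ Matrix.unitaryGroup (X × Y) ℂ) (p : X × AddChar X ℂ) :
    correctThenApply U p ∈ Matrix.unitaryGroup (X × Y) ℂ :=
  mul_mem hU (Matrix.kronecker_mem_unitary (Unitary.star_mem (weyl_mem_unitaryGroup p))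
    (one_mem _))

theorem sum_bell_mul_correctThenApply {X Y : Type} [AddCommGroup X] [Fintype X]
    [DecidableEq X] [Fintype Y] [DecidableEq Y] (U : Matrix (X × Y) (X × Y) ℂ) (p : X × AddChar X ℂ)
    (z : X × Y) (x : X) (y : Y) :
    ∑ s, bell p s x * correctThenApply U p z (s, y) = invSqrtCard X * U z (x, y) := by
  have hW := fun y y' =>
    congrFun (congrFun (Matrix.mem_unitaryGroup_iff'.1 (weyl_mem_unitaryGroup p)) y) y'
  simp only [Matrix.star_eq_conjTranspose, Matrix.mul_apply, Matrix.conjTranspose_apply,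
    Matrix.one_apply] at hW
  have h1 : ∀ s, correctThenApply U p z (s, y) = ∑ x', U z (x', y) * star (weyl p s x') := by
    intro s
    simp [correctThenApply, Matrix.mul_apply, Fintype.sum_prod_type, Matrix.one_apply]
  calc ∑ s, bell p s x * correctThenApply U p z (s, y)
      = ∑ x', invSqrtCard X * U z (x', y) * ∑ s, star (weyl p s x') * weyl p s x := by
        simp_rw [h1, Finset.mul_sum]
        rw [Finset.sum_comm]
        refine Finset.sum_congr rfl fun x' _ => Finset.sum_congr rfl fun s _ => ?_
        rw [bell, Matrix.smul_apply, smul_eq_mul]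
        ring
    _ = _ := by
        simp_rw [hW]
        simp

/-- The shared resource: one maximally entangled state for the teleportation of the `X`-part, and
for each of the `N + 1` ports one of the size `X × Y` of the port and one for the `Y`-part on its
way back. -/
abbrev Resource (X Y : Type) (N : ℕ) : Type :=
  X × ((Fin (N + 1) → X × Y) × (Fin (N + 1) → Y))

/-- Alice's first operation: she teleports the `X`-part, with outcome `p`, to Bob, and then treats
every port as if it contained the result, undoing the Pauli error, applying `U` and teleporting the
`Y`-part back. -/
def aliceFirst {U : Matrix (X × Y) (X × Y) ℂ} (hU : U ∈ Matrix.unitaryGroup (X × Y) ℂ) (N : ℕ) :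
    LocalOperation ((X × AddChar X ℂ) × (Fin (N + 1) → Y × AddChar Y ℂ))
      (X × Resource X Y N) (Fin (N + 1) → X) where
  op o := Matrix.of fun κ z => bell o.1 z.2.1 z.1 *
    ∏ k, sendBack (correctThenApply U o.1) (o.2 k) (κ k) (z.2.2.1 k, z.2.2.2 k)
  complete := by
    rw [sum_op_conj_mul_eq_one_iff]
    rintro ⟨x, s₁, s₂, s₃⟩ ⟨x', t₁, t₂, t₃⟩
    simp only [Matrix.of_apply]
    rw [Fintype.sum_prod_type]
    have hst : (fun k => (s₂ k, s₃ k)) = (fun k => (t₂ k, t₃ k)) ↔ s₂ = t₂ ∧ s₃ = t₃ := by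
      simp [funext_iff, forall_and]
    have h1 : ∀ p : X × AddChar X ℂ, ∑ q : Fin (N + 1) → Y × AddChar Y ℂ, ∑ κ : Fin (N + 1) → X,
        star (bell p s₁ x *
          ∏ k, sendBack (correctThenApply U p) (q k) (κ k) (s₂ k, s₃ k)) *
        (bell p t₁ x' * ∏ k, sendBack (correctThenApply U p) (q k) (κ k) (t₂ k, t₃ k))
        = star (bell p s₁ x) * bell p t₁ x' * if s₂ = t₂ ∧ s₃ = t₃ then 1 else 0 := by
      intro p
      have h2 := sum_star_prod_mul_prod (sendBack (correctThenApply U p))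
        (sum_star_sendBack_mul_sendBack (correctThenApply_mem_unitaryGroup hU p))
        (fun k => (s₂ k, s₃ k)) (fun k => (t₂ k, t₃ k))
      rw [if_congr hst rfl rfl] at h2
      rw [← h2]
      simp_rw [Finset.mul_sum]
      refine Finset.sum_congr rfl fun q _ => Finset.sum_congr rfl fun κ _ => ?_
      rw [star_mul']
      ring
    simp_rw [h1]
    rw [← Finset.sum_mul, sum_star_bell_mul_bell, mul_ite, mul_one, mul_zero, ← ite_and]
    refine if_congr ?_ rfl rfl
    simp only [Prod.ext_iff]
    tauto

/-- The measurement operators of the successful outcomes of Bob's first operation: port-based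
teleportation of the `Y`-part and the register that receives the `X`-part. -/
def bobKraus (T : Matrix (Fin N → X × Y) (Fin N → X × Y) ℂ)
    (o : Fin (N + 1) × (Fin N → X × Y)) : Matrix (Fin (N + 1) → Y) (Y × Resource X Y N) ℂ :=
  Matrix.of fun σ z => if z.2.2.2 = σ then
    (T * (portEmbedding (D := X × Y) o.1)ᴴ) o.2 ((z.2.1, z.1), z.2.2.1) else 0

theorem posSemidef_one_sub_sum_bobKraus {X Y : Type} [Fintype X] [DecidableEq X] [Fintype Y]
    [DecidableEq Y] {T : Matrix (Fin N → X × Y) (Fin N → X × Y) ℂ}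
    (hT : ∀ v : (X × Y) × (Fin (N + 1) → X × Y) → ℂ, ∑ i : Fin (N + 1), ∑ t,
      ‖((T * (portEmbedding (D := X × Y) i)ᴴ) *ᵥ v) t‖ ^ 2 ≤ ∑ z, ‖v z‖ ^ 2) :
    (1 - ∑ o, (bobKraus T o)ᴴ * bobKraus T o).PosSemidef := by
  refine posSemidef_one_sub_of_sum_norm_sq_le _ fun v => ?_
  have h1 : ∀ (o : Fin (N + 1) × (Fin N → X × Y)) (σ : Fin (N + 1) → Y),
      (bobKraus T o *ᵥ v) σ = ((T * (portEmbedding (D := X × Y) o.1)ᴴ) *ᵥ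
        fun z => v (z.1.2, (z.1.1, (z.2, σ)))) o.2 := by
    intro o σ
    simp only [Matrix.mulVec, dotProduct, bobKraus, Matrix.of_apply, Fintype.sum_prod_type, ite_mul,
      zero_mul, Finset.sum_ite_eq', Finset.mem_univ, if_true]
    exact Finset.sum_comm
  calc ∑ o, ∑ σ, ‖(bobKraus T o *ᵥ v) σ‖ ^ 2
      = ∑ σ : Fin (N + 1) → Y, ∑ i : Fin (N + 1), ∑ t,
        ‖((T * (portEmbedding (D := X × Y) i)ᴴ) *ᵥ
          fun z => v (z.1.2, (z.1.1, (z.2, σ)))) t‖ ^ 2 := by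
        simp_rw [h1]
        rw [Finset.sum_comm]
        simp_rw [Fintype.sum_prod_type]
    _ ≤ ∑ σ : Fin (N + 1) → Y, ∑ z : (X × Y) × (Fin (N + 1) → X × Y),
        ‖v (z.1.2, (z.1.1, (z.2, σ)))‖ ^ 2 := Finset.sum_le_sum fun σ _ => hT _
    _ = ∑ z, ‖v z‖ ^ 2 := by
        rw [Finset.sum_comm]
        rw [← Fintype.sum_prod_type' (f := fun (z : (X × Y) × (Fin (N + 1) → X × Y)) σ =>
          ‖v (z.1.2, (z.1.1, (z.2, σ)))‖ ^ 2)]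
        let e : ((X × Y) × (Fin (N + 1) → X × Y)) × (Fin (N + 1) → Y) ≃ Y × Resource X Y N :=
          { toFun := fun z => (z.1.1.2, (z.1.1.1, (z.1.2, z.2)))
            invFun := fun z => (((z.2.1, z.1), z.2.2.1), z.2.2.2)
            left_inv := fun _ => rfl
            right_inv := fun _ => rfl }
        exact Equiv.sum_comp e fun z => ‖v z‖ ^ 2

/-- Bob's first operation, on sufficiently many ports. The second claim is the success probability
of the port-based teleportation. -/
theorem exists_bobFirst (X Y : Type) [Fintype X] [DecidableEq X] [Nonempty X] [Fintype Y]
    [DecidableEq Y] [Nonempty Y] {ε : ℝ} (hε : 0 < ε) :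
    ∃ (N : ℕ) (T : Matrix (Fin N → X × Y) (Fin N → X × Y) ℂ) (d : ℕ)
      (B : LocalOperation ((Fin (N + 1) × (Fin N → X × Y)) ⊕ Fin d) (Y × Resource X Y N)
        (Fin (N + 1) → Y)),
      (∀ o, B.op (Sum.inl o) = bobKraus T o) ∧
      (1 - ε) * (Fintype.card (X × Y) : ℝ) ^ (N + 1) ≤ (N + 1) * ∑ s, ∑ t, ‖T s t‖ ^ 2 := by
  obtain ⟨N, T, hT, hsucc⟩ := exists_portBasedTeleportation (X × Y) hε
  obtain ⟨d, B, hB⟩ := exists_localOperation_extending _ (posSemidef_one_sub_sum_bobKraus hT)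
  exact ⟨N, T, d, B, hB, hsucc⟩

/-- The amplitude of what happens in the ports other than the `i`-th one. -/
def restAmplitude (U : Matrix (X × Y) (X × Y) ℂ) (T : Matrix (Fin N → X × Y) (Fin N → X × Y) ℂ)
    (p : X × AddChar X ℂ) (q : Fin N → Y × AddChar Y ℂ) (t : Fin N → X × Y) (f : Fin N → X)
    (h : Fin N → Y) : ℂ :=
  ∑ t', T t t' * ∏ l, sendBack (correctThenApply U p) (q l) (f l) (t' l, h l)

theorem sum_norm_sq_restAmplitude {U : Matrix (X × Y) (X × Y) ℂ}
    (hU : U ∈ Matrix.unitaryGroup (X × Y) ℂ) (T : Matrix (Fin N → X × Y) (Fin N → X × Y) ℂ)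
    (p : X × AddChar X ℂ) (t : Fin N → X × Y) (h : Fin N → Y) :
    ∑ q, ∑ f, ‖restAmplitude U T p q t f h‖ ^ 2 = ∑ t', ‖T t t'‖ ^ 2 := by
  refine sum_norm_sq_of_orthonormal (fun (q : Fin N → Y × AddChar Y ℂ) (f : Fin N → X)
    (t' : Fin N → X × Y) => ∏ l, sendBack (correctThenApply U p) (q l) (f l) (t' l, h l))
    (fun s s' => ?_) (T t)
  rw [sum_star_prod_mul_prod (sendBack (correctThenApply U p))
    (sum_star_sendBack_mul_sendBack (correctThenApply_mem_unitaryGroup hU p))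
    (fun l => (s l, h l)) (fun l => (s' l, h l))]
  refine if_congr ?_ rfl rfl
  simp [funext_iff]

/-- After the outcomes `(p, q)` and `(i, t)` of the first operations, the kept registers and the
remaining resources are in a product form in which the `i`-th port is separated. -/
theorem sum_aliceFirst_mul_bobKraus {U : Matrix (X × Y) (X × Y) ℂ}
    (hU : U ∈ Matrix.unitaryGroup (X × Y) ℂ) (T : Matrix (Fin N → X × Y) (Fin N → X × Y) ℂ)
    (p : X × AddChar X ℂ) (q : Fin (N + 1) → Y × AddChar Y ℂ) (i : Fin (N + 1))
    (t : Fin N → X × Y) (ξ : X) (f : Fin N → X) (η : Y) (h : Fin N → Y) (x : X) (y : Y) :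
    ∑ s, (aliceFirst hU N).op (p, q) (i.insertNth ξ f) (x, s) *
        bobKraus T (i, t) (i.insertNth η h) (y, s)
      = (∑ s, bell p s x * sendBack (correctThenApply U p) (q i) ξ ((s, y), η)) *
        restAmplitude U T p (i.removeNth q) t f h := by
  have hM : ∀ (s₁ : X) (s₂ : Fin (N + 1) → X × Y),
      (T * (portEmbedding (D := X × Y) i)ᴴ) t ((s₁, y), s₂)
        = ∑ t', if s₂ = i.insertNth (s₁, y) t' then T t t' else 0 := by
    intro s₁ s₂
    simp [Matrix.mul_apply, portEmbedding]
  simp only [Fintype.sum_prod_type (α₁ := X), Fintype.sum_prod_type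
    (α₁ := Fin (N + 1) → X × Y), aliceFirst, bobKraus, Matrix.of_apply, mul_ite, mul_zero,
    Finset.sum_ite_eq', Finset.mem_univ, if_true, hM, Finset.mul_sum]
  rw [Finset.sum_mul]
  refine Finset.sum_congr rfl fun s₁ _ => ?_
  rw [Finset.sum_comm, restAmplitude, Finset.mul_sum]
  refine Finset.sum_congr rfl fun t' _ => ?_
  simp only [Finset.sum_ite_eq', Finset.mem_univ, if_true]
  rw [Fin.prod_univ_succAbove _ i]
  simp only [Fin.insertNth_apply_same, Fin.insertNth_apply_succAbove, Fin.removeNth_apply]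
  ring

/-- The port selected by Bob's outcome; for the failure outcomes it does not matter. -/
def selectedPort {d : ℕ} : (Fin (N + 1) × (Fin N → X × Y)) ⊕ Fin d → Fin (N + 1) :=
  Sum.elim Prod.fst fun _ => 0

/-- The second operations complete the application of `U`. -/
theorem sum_second_mul_first {U : Matrix (X × Y) (X × Y) ℂ}
    (hU : U ∈ Matrix.unitaryGroup (X × Y) ℂ) (T : Matrix (Fin N → X × Y) (Fin N → X × Y) ℂ)
    (p : X × AddChar X ℂ) (q : Fin (N + 1) → Y × AddChar Y ℂ) (i : Fin (N + 1))
    (t : Fin N → X × Y) (f : Fin N → X) (h : Fin N → Y) (ξ x : X) (η y : Y) :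
    ∑ κ, ∑ σ, (selectOp i (1 : Matrix X X ℂ) (one_mem _)).op f ξ κ *
        (selectOp i (weyl (q i)) (weyl_mem_unitaryGroup _)).op h η σ *
        ∑ s, (aliceFirst hU N).op (p, q) κ (x, s) * bobKraus T (i, t) σ (y, s)
      = invSqrtCard X * invSqrtCard Y * restAmplitude U T p (i.removeNth q) t f h *
        U (ξ, η) (x, y) := by
  simp_rw [mul_assoc, ← Finset.mul_sum]
  rw [sum_selectOp_mul i (one_mem _) f ξ (fun κ =>
    ∑ σ, (selectOp i (weyl (q i)) (weyl_mem_unitaryGroup _)).op h η σ *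
        ∑ s, (aliceFirst hU N).op (p, q) κ (x, s) * bobKraus T (i, t) σ (y, s))]
  simp only [Matrix.one_apply, ite_mul, one_mul, zero_mul, Finset.sum_ite_eq, Finset.mem_univ,
    if_true]
  rw [sum_selectOp_mul i (weyl_mem_unitaryGroup _) h η (fun σ =>
    ∑ s, (aliceFirst hU N).op (p, q) (i.insertNth ξ f) (x, s) * bobKraus T (i, t) σ (y, s))]
  simp_rw [sum_aliceFirst_mul_bobKraus]
  calc ∑ σ, weyl (q i) η σ * ((∑ s, bell p s x *
        sendBack (correctThenApply U p) (q i) ξ ((s, y), σ)) *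
          restAmplitude U T p (i.removeNth q) t f h)
      = (∑ s, bell p s x * ∑ σ, weyl (q i) η σ *
          sendBack (correctThenApply U p) (q i) ξ ((s, y), σ)) *
          restAmplitude U T p (i.removeNth q) t f h := by
        simp_rw [← mul_assoc, ← Finset.sum_mul, Finset.mul_sum]
        rw [Finset.sum_comm]
        congr 1
        exact Finset.sum_congr rfl fun s _ => Finset.sum_congr rfl fun σ _ => by ring
    _ = _ := by
        simp_rw [sum_weyl_mul_sendBack, mul_left_comm _ (invSqrtCard Y), ← Finset.mul_sum]
        rw [sum_bell_mul_correctThenApply]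
        ring

/-- The total weight of the successful records. -/
theorem sum_norm_sq_success {U : Matrix (X × Y) (X × Y) ℂ}
    (hU : U ∈ Matrix.unitaryGroup (X × Y) ℂ) (T : Matrix (Fin N → X × Y) (Fin N → X × Y) ℂ) :
    ∑ pq : (X × AddChar X ℂ) × (Fin (N + 1) → Y × AddChar Y ℂ),
      ∑ o : Fin (N + 1) × (Fin N → X × Y), ∑ f : Fin N → X, ∑ h : Fin N → Y,
        ‖invSqrtCard X * invSqrtCard Y *
          restAmplitude U T pq.1 (o.1.removeNth pq.2) o.2 f h‖ ^ 2
      = (Fintype.card X : ℝ) * (Fintype.card Y : ℝ) ^ (N + 1) *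
        ((N + 1) * ∑ t, ∑ t', ‖T t t'‖ ^ 2) := by
  have hX : (Fintype.card X : ℝ) ≠ 0 := by
    have : Nonempty X := ⟨0⟩
    exact_mod_cast Fintype.card_ne_zero
  have hY : (Fintype.card Y : ℝ) ≠ 0 := by
    have : Nonempty Y := ⟨0⟩
    exact_mod_cast Fintype.card_ne_zero
  have h1 : ∀ (p : X × AddChar X ℂ) (i : Fin (N + 1)) (t : Fin N → X × Y),
      ∑ q : Fin (N + 1) → Y × AddChar Y ℂ, ∑ f : Fin N → X, ∑ h : Fin N → Y,
        ‖restAmplitude U T p (i.removeNth q) t f h‖ ^ 2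
      = (Fintype.card Y : ℝ) ^ 2 * ((Fintype.card Y : ℝ) ^ N * ∑ t', ‖T t t'‖ ^ 2) := by
    intro p i t
    rw [sum_insertNth i]
    simp only [Fin.removeNth_insertNth, Finset.sum_const, Finset.card_univ, Fintype.card_prod,
      AddChar.card_eq, nsmul_eq_mul]
    have h2 : ∀ q : Fin N → Y × AddChar Y ℂ, ∑ f : Fin N → X, ∑ h : Fin N → Y,
        ‖restAmplitude U T p q t f h‖ ^ 2 = ∑ h : Fin N → Y, ∑ f : Fin N → X,
        ‖restAmplitude U T p q t f h‖ ^ 2 := fun q => Finset.sum_comm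
    simp_rw [h2]
    rw [Finset.sum_comm]
    simp only [sum_norm_sq_restAmplitude hU, Finset.sum_const, Finset.card_univ, nsmul_eq_mul,
      Fintype.card_pi, Finset.prod_const, Fintype.card_fin]
    push_cast
    ring
  have h3 : ∀ p : X × AddChar X ℂ, ∑ q : Fin (N + 1) → Y × AddChar Y ℂ,
      ∑ o : Fin (N + 1) × (Fin N → X × Y), ∑ f : Fin N → X, ∑ h : Fin N → Y,
        ‖restAmplitude U T p (o.1.removeNth q) o.2 f h‖ ^ 2
      = (N + 1) * ((Fintype.card Y : ℝ) ^ 2 * ((Fintype.card Y : ℝ) ^ N *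
          ∑ t, ∑ t', ‖T t t'‖ ^ 2)) := by
    intro p
    rw [Finset.sum_comm, Fintype.sum_prod_type]
    simp only [h1, ← Finset.mul_sum, Finset.sum_const, Finset.card_univ, Fintype.card_fin,
      nsmul_eq_mul]
    push_cast
    ring
  simp only [norm_mul, mul_pow, norm_invSqrtCard_sq, ← Finset.mul_sum]
  rw [Fintype.sum_prod_type]
  simp only [h3, Finset.sum_const, Finset.card_univ, Fintype.card_prod, AddChar.card_eq,
    nsmul_eq_mul]
  push_cast
  field_simp
  ring

end

theorem card_bits (n : ℕ) : Fintype.card (Bits n) = 2 ^ n := by simp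

end NonlocalComputation

end

open NonlocalComputation in
theorem mainTheorem2 (nA nB : ℕ)
    (U : Matrix (NonlocalComputation.Bits nA × NonlocalComputation.Bits nB)
      (NonlocalComputation.Bits nA × NonlocalComputation.Bits nB) ℂ)
    (hU : U ∈ Matrix.unitaryGroup
      (NonlocalComputation.Bits nA × NonlocalComputation.Bits nB) ℂ)
    (ε : ℝ) (hε : 0 < ε) :
    ∃ N : ℕ, ∀ m : ℕ, N ≤ m →
      ∃ P : NonlocalComputation.OneRoundProtocol nA nB m,
        ∀ (E : Type u) [NormedAddCommGroup E] [InnerProductSpace ℂ E] [CompleteSpace E]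
          (ψ : NonlocalComputation.StateABE nA nB E), ‖ψ‖ = 1 →
          P.failureProb ψ (NonlocalComputation.applyAB U ψ) ≤ ε := by
  obtain ⟨N, T, d, B, hB, hsucc⟩ := exists_bobFirst (Bits nA) (Bits nB) hε
  have hU' : U ∈ @Matrix.unitaryGroup (Bits nA × Bits nB) instDecidableEqProd _ ℂ _ _ := by
    convert hU
  have hcard : Fintype.card (Resource (Bits nA) (Bits nB) N)
      = 2 ^ (nA + ((nA + nB) * (N + 1) + nB * (N + 1))) := by
    simp only [Fintype.card_prod, Fintype.card_pi, Finset.prod_const, Finset.card_univ,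
      Fintype.card_fin, pow_add, pow_mul]
  refine ⟨nA + ((nA + nB) * (N + 1) + nB * (N + 1)), fun m hm => ?_⟩
  obtain ⟨r, rfl⟩ := Nat.exists_eq_add_of_le hm
  have e : Bits (nA + ((nA + nB) * (N + 1) + nB * (N + 1)) + r)
      ≃ Resource (Bits nA) (Bits nB) N × Bits r := by
    refine Fintype.equivOfCardEq ?_
    rw [Fintype.card_prod, hcard, card_bits, card_bits, pow_add]
  refine exists_oneRoundProtocol e (aliceFirst hU' N) B
    (fun _ o => selectOp (selectedPort o) 1 (one_mem _))
    (fun o pq => selectOp (selectedPort o) (weyl (pq.2 (selectedPort o)))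
      (weyl_mem_unitaryGroup _)) hU
    (fun pq o f h => Sum.elim (fun it => invSqrtCard (Bits nA) * invSqrtCard (Bits nB) *
      restAmplitude U T pq.1 (it.1.removeNth pq.2) it.2 f h) (fun _ => 0) o) ?_ ?_
  · rintro ⟨p, q⟩ (⟨i, t⟩ | l) f h hne ξ η x y
    · simp only [hB]
      exact sum_second_mul_first hU' T p q i t f h ξ x η y
    · exact absurd rfl hne
  · simp only [Fintype.sum_sum_type, Sum.elim_inl, Sum.elim_inr, norm_zero, ne_eq,
      OfNat.ofNat_ne_zero, not_false_eq_true, zero_pow, Finset.sum_const_zero, add_zero]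
    rw [sum_norm_sq_success hU' T]
    have hR : (Fintype.card (Resource (Bits nA) (Bits nB) N) : ℝ)
        = (Fintype.card (Bits nA) : ℝ) * (Fintype.card (Bits nB) : ℝ) ^ (N + 1)
          * (Fintype.card (Bits nA × Bits nB) : ℝ) ^ (N + 1) := by
      simp only [Fintype.card_prod, Fintype.card_pi, Finset.prod_const, Finset.card_univ,
        Fintype.card_fin]
      push_cast
      ring
    rw [hR]
    calc _ = (Fintype.card (Bits nA) : ℝ) * (Fintype.card (Bits nB) : ℝ) ^ (N + 1)
          * ((1 - ε) * (Fintype.card (Bits nA × Bits nB) : ℝ) ^ (N + 1)) := by ring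
      _ ≤ _ := by gcongr
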